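/- Let $n\ge 1$, $m\ge 0$ and $k\ge n$ be integers, $A\in\mathbb R^{n\times n}$, $C\in\mathbb R^{m\times n}$, and let $Q\in\mathbb R^{n\times n}$ and $R\in\mathbb R^{m\times m}$ be symmetric positive definite. Assume that $(A,C)$ is observable. For symmetric matrices, $>$ and $\ge$ denote the positive (semi)definite order, and $\sigma_{\max},\sigma_{\min}$ the largest and smallest eigenvalue; a matrix is stable if all its complex eigenvalues have modulus $<1$. For $\theta>0$ consider the Riccati recursion of the update risk sensitive filter (U-RSF) $$P_{t+1}=r_\theta(P_t):=A\,(P_t^{-1}+C^\top R^{-1}C-\theta I)^{-1}A^\top+Q,\qquad L_t=P_tC^\top(CP_tC^\top+R)^{-1}.$$ **The bound $\beta_{\rho,\alpha}$.** Let $0<\alpha\le 1$ and $G\in\mathbb R^{n\times m}$ be such that $A-\alpha GC$ is stable, let $r<1$ be the largest modulus of its eigenvalues, and let $1<\rho<r^{-1}$ (with $r^{-1}=\infty$ if $r=0$). Let $\Sigma_{\rho,\alpha}$ be the solution of $$\Sigma=\rho^2(A-\alpha GC)\,\Sigma\,(A-\alpha GC)^\top+GRG^\top+Q,\qquad \beta_{\rho,\alpha}:=\sigma_{\min}\!\Big(\tfrac{\rho^2-1}{\rho^2}\Sigma_{\rho,\alpha}^{-1}+(1-\alpha^2)C^\top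 R^{-1}C\Big).$$ **The bound $\phi_k$.** Let $Q^{1/2}$ be any square matrix with $Q^{1/2}(Q^{1/2})^\top=Q$, and let $\mathcal L_k$ and $\mathcal H_k$ be the block upper triangular Toeplitz matrices with first block rows $(0,L_1,\dots,L_{k-1})$ and $(0,H_1,\dots,H_{k-1})$, where here $L_t=A^{t-1}Q^{1/2}$ and $H_t=CA^{t-1}Q^{1/2}$. Put $\mathcal R_k=I_k\otimes R$, $\mathcal O_k=[(CA^{k-1})^\top\cdots(CA)^\top\ C^\top]^\top$, $\mathcal O_k^R=[(A^{k-1})^\top\cdots A^\top\ I]^\top$, $$\mathcal M_k=\mathcal L_k(I+\mathcal H_k^\top\mathcal R_k^{-1}\mathcal H_k)^{-1}\mathcal L_k^\top,\qquad \mathcal J_k=\mathcal O_k^R-\mathcal L_k\mathcal H_k^\top(\mathcal R_k+\mathcal H_k\mathcal H_k^\top)^{-1}\mathcal O_k,$$ $$\mathbf R_k(\phi)=\mathcal O_k^\top(\mathcal R_k+\mathcal H_k\mathcal H_k^\top)^{-1}\mathcal O_k+\mathcal J_k^\top(\mathcal M_k-\phi^{-1}I)^{-1}\mathcal J_k.$$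 Let $\phi_k$ be the supremum of all $\phi\in(0,\sigma_{\max}(\mathcal M_k)^{-1})$ for which $\mathbf R_k(\phi)$ is positive definite (with $0^{-1}=\infty$). Then the equation for $\Sigma$ has exactly one solution $\Sigma_{\rho,\alpha}$, it is positive definite, and $\theta_{MAX}:=\min\{\beta_{\rho,\alpha},\phi_k\}>0$. Moreover, for every $\theta\in(0,\theta_{MAX}]$, the equation $P=r_\theta(P)$ has exactly one positive definite solution $P$; it satisfies $P^{-1}+C^\top R^{-1}C-\theta I>0$. There is a matrix $L$ such that for every $P_0$ with $0<P_0\le\Sigma_{\rho,\alpha}$ the recursion satisfies $P_t>0$ and $P_t^{-1}+C^\top R^{-1}C-\theta I>0$ for all $t\ge0$, and $P_t\to P$ and $L_t\to L$ as $t\to\infty$; and $A(I-LC)$ is stable. -/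

import Mathlib

open Filter Topology Matrix
open scoped Kronecker ENNReal

namespace URSF

noncomputable section

/-! ### Notions from linear algebra -/

/-- The largest eigenvalue of a real symmetric matrix. -/
def sigmaMax {ι : Type*} [Fintype ι] [DecidableEq ι] (M : Matrix ι ι ℝ) : ℝ :=
  sSup (spectrum ℝ M)

/-- The smallest eigenvalue of a real symmetric matrix. -/
def sigmaMin {ι : Type*} [Fintype ι] [DecidableEq ι] (M : Matrix ι ι ℝ) : ℝ :=
  sInf (spectrum ℝ M)

/-- A real square matrix is stable (in discrete time) if all its complex eigenvalues lie in the
open unit disc. -/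
def IsStable {ι : Type*} [Fintype ι] [DecidableEq ι] (M : Matrix ι ι ℝ) : Prop :=
  ∀ z ∈ spectrum ℂ (M.map (algebraMap ℝ ℂ)), ‖z‖ < 1

/-- The largest modulus of a complex eigenvalue of a real square matrix, in `[0, ∞]` (so that the
inverse of `0` is `∞`). -/
def maxModulus {ι : Type*} [Fintype ι] [DecidableEq ι] (M : Matrix ι ι ℝ) : ℝ≥0∞ :=
  spectralRadius ℂ (M.map (algebraMap ℝ ℂ))

/-- The pair `(A, C)` is observable: the observability matrix with block rows
`C, C A, …, C A ^ (n - 1)` has rank `n`. -/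
def IsObservable {n m : ℕ} (A : Matrix (Fin n) (Fin n) ℝ) (C : Matrix (Fin m) (Fin n) ℝ) : Prop :=
  (Matrix.of fun (p : Fin n × Fin m) (j : Fin n) => (C * A ^ (p.1 : ℕ)) p.2 j).rank = n

/-- The block upper triangular Toeplitz matrix with first block row `T 0, T 1, …, T (k - 1)`. -/
def blockToeplitz (k : ℕ) {p q : Type*} (T : ℕ → Matrix p q ℝ) :
    Matrix (Fin k × p) (Fin k × q) ℝ :=
  Matrix.of fun i j => if i.1 ≤ j.1 then T ((j.1 : ℕ) - (i.1 : ℕ)) i.2 j.2 else 0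

/-! ### The risk sensitive Riccati recursion -/

section Recursion

variable {n m : ℕ} (A : Matrix (Fin n) (Fin n) ℝ) (C : Matrix (Fin m) (Fin n) ℝ)
  (Q : Matrix (Fin n) (Fin n) ℝ) (R : Matrix (Fin m) (Fin m) ℝ)

/-- `P⁻¹ + Cᵀ R⁻¹ C - θ I`, the inverse of the error covariance matrix `V` of the update. -/
def invV (θ : ℝ) (P : Matrix (Fin n) (Fin n) ℝ) : Matrix (Fin n) (Fin n) ℝ :=
  P⁻¹ + Cᵀ * R⁻¹ * C - θ • (1 : Matrix (Fin n) (Fin n) ℝ)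

/-- The risk sensitive Riccati operator `P ↦ A (P⁻¹ + Cᵀ R⁻¹ C - θ I)⁻¹ Aᵀ + Q`. -/
def riccati (θ : ℝ) (P : Matrix (Fin n) (Fin n) ℝ) : Matrix (Fin n) (Fin n) ℝ :=
  A * (invV C R θ P)⁻¹ * Aᵀ + Q

/-- The sequence generated by the recursion `P_{t+1} = riccati P_t` from the initial value `P₀`. -/
def riccatiSeq (θ : ℝ) (P₀ : Matrix (Fin n) (Fin n) ℝ) : ℕ → Matrix (Fin n) (Fin n) ℝ
  | 0 => P₀
  | t + 1 => riccati A C Q R θ (riccatiSeq θ P₀ t)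

/-- The filtering gain `L = P Cᵀ (C P Cᵀ + R)⁻¹`. -/
def gain (P : Matrix (Fin n) (Fin n) ℝ) : Matrix (Fin n) (Fin m) ℝ :=
  P * Cᵀ * (C * P * Cᵀ + R)⁻¹

end Recursion

/-! ### The bound `φ_k` from the observability Gramian of the `k`-fold Riccati map -/

section Gramian

variable {n m : ℕ} (A : Matrix (Fin n) (Fin n) ℝ) (C : Matrix (Fin m) (Fin n) ℝ)
  (R : Matrix (Fin m) (Fin m) ℝ)
  (B : Matrix (Fin n) (Fin n) ℝ) -- a square root of `Q`, that is, `B Bᵀ = Q`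
  (k : ℕ)

/-- `𝒪_k`, with block rows `C A ^ (k - 1), …, C A, C`. -/
def obsO : Matrix (Fin k × Fin m) (Fin n) ℝ :=
  Matrix.of fun i j => (C * A ^ (k - 1 - (i.1 : ℕ))) i.2 j

/-- `𝒪_k^R`, with block rows `A ^ (k - 1), …, A, I`. -/
def obsOR : Matrix (Fin k × Fin n) (Fin n) ℝ :=
  Matrix.of fun i j => (A ^ (k - 1 - (i.1 : ℕ))) i.2 j

/-- The sequence `0, L_1, L_2, …` with `L_t = A ^ (t - 1) B`. -/
def blockL : ℕ → Matrix (Fin n) (Fin n) ℝ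
  | 0 => 0
  | t + 1 => A ^ t * B

/-- The sequence `0, H_1, H_2, …` with `H_t = C A ^ (t - 1) B`. -/
def blockH : ℕ → Matrix (Fin m) (Fin n) ℝ
  | 0 => 0
  | t + 1 => C * A ^ t * B

/-- `ℒ_k`. -/
def toepL : Matrix (Fin k × Fin n) (Fin k × Fin n) ℝ := blockToeplitz k (blockL A B)

/-- `ℋ_k`. -/
def toepH : Matrix (Fin k × Fin m) (Fin k × Fin n) ℝ := blockToeplitz k (blockH A C B)

/-- `I_k ⊗ R`, the covariance matrix of `k` successive observation noises. -/
def noiseCov : Matrix (Fin k × Fin m) (Fin k × Fin m) ℝ :=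
  (1 : Matrix (Fin k) (Fin k) ℝ) ⊗ₖ R

/-- `ℒ_k (I + ℋ_kᵀ (I_k ⊗ R)⁻¹ ℋ_k)⁻¹ ℒ_kᵀ`. -/
def errCov : Matrix (Fin k × Fin n) (Fin k × Fin n) ℝ :=
  toepL A B k * (1 + (toepH A C B k)ᵀ * (noiseCov R k)⁻¹ * toepH A C B k)⁻¹ * (toepL A B k)ᵀ

/-- `S_k` for the value `φ` of the risk sensitivity parameter. -/
def matS (φ : ℝ) : Matrix (Fin k × Fin n) (Fin k × Fin n) ℝ :=
  errCov A C R B k - φ⁻¹ • (1 : Matrix (Fin k × Fin n) (Fin k × Fin n) ℝ)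

/-- `𝒥_k`. -/
def matJ : Matrix (Fin k × Fin n) (Fin n) ℝ :=
  obsOR A k - toepL A B k * (toepH A C B k)ᵀ *
    (noiseCov R k + toepH A C B k * (toepH A C B k)ᵀ)⁻¹ * obsO A C k

/-- The observability Gramian `𝐑_k` for the value `φ` of the risk sensitivity parameter. -/
def gramian (φ : ℝ) : Matrix (Fin n) (Fin n) ℝ :=
  (obsO A C k)ᵀ * (noiseCov R k + toepH A C B k * (toepH A C B k)ᵀ)⁻¹ * obsO A C k +
    (matJ A C R B k)ᵀ * (matS A C R B k φ)⁻¹ * matJ A C R B k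

/-- `φ_k`: the largest value (as a supremum) in the interval `(0, 1 / σ_max)`, where `σ_max` is the
largest eigenvalue of `errCov` and `1 / 0 = ∞`, for which the Gramian `𝐑_k` is positive
definite. -/
def phiK : ℝ :=
  sSup {φ : ℝ | 0 < φ ∧ φ * sigmaMax (errCov A C R B k) < 1 ∧ (gramian A C R B k φ).PosDef}

end Gramian

/-! ### The bound `β_{ρ,α}` from a Lyapunov equation -/

section Lyapunov

variable {n m : ℕ} (A : Matrix (Fin n) (Fin n) ℝ) (C : Matrix (Fin m) (Fin n) ℝ)
  (Q : Matrix (Fin n) (Fin n) ℝ) (R : Matrix (Fin m) (Fin m) ℝ)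
  (G : Matrix (Fin n) (Fin m) ℝ) (ρ α : ℝ)

/-- `X` solves the Lyapunov equation
`X = ρ² (A - α G C) X (A - α G C)ᵀ + G R Gᵀ + Q`. -/
def LyapunovEq (X : Matrix (Fin n) (Fin n) ℝ) : Prop :=
  X = ρ ^ 2 • ((A - α • (G * C)) * X * (A - α • (G * C))ᵀ) + G * R * Gᵀ + Q

/-- `β_{ρ,α}`, for the solution `X` of the Lyapunov equation. -/
def beta (X : Matrix (Fin n) (Fin n) ℝ) : ℝ :=
  sigmaMin (((ρ ^ 2 - 1) / ρ ^ 2) • X⁻¹ + (1 - α ^ 2) • (Cᵀ * R⁻¹ * C))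

end Lyapunov

end

end URSF

/-! On positive definite `P` with `invV P > 0` the Riccati map is increasing, since it inverts
twice. The definition of `beta` makes the Lyapunov solution `S` a supersolution for `θ ≤ beta`
(`riccati_le_of_le_beta`): bounding a maximum by Young's inequality with the weights `ρ² S` and `R`
reproduces exactly the terms of the Lyapunov equation. As `Q` is a subsolution below `S`, the
iterates of `S` decrease, those of `Q` increase, and both converge to fixed points. Every other
orbit below `S` is squeezed between them after one step (`exists_tendsto_riccatiSeq`), so
convergence follows from uniqueness of the fixed point.

Uniqueness rests on `phiK`. Completing squares twice shows that the Gramian form bounds from below,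
over all noises, the noise energy minus `φ` times the state energy; this cost is therefore
nonnegative for `θ ≤ phiK` (`sum_cost_nonneg`). Along the backward dynamics `Φ = (invV P)⁻¹ Aᵀ P⁻¹`
of a fixed point, the form of `P⁻¹` drops in `k` steps by such a cost plus a strictly positive term,
so the powers of `Φ ^ k` tend to zero (`quadForm_backward_pow_lt`). For two fixed points the
difference `Z` of the inverses satisfies `Z = Φᵀ Z Φ'`, hence vanishes (`riccati_unique`).

Observability makes `phiK` positive (`phiK_pos`), and `P` itself is a Lyapunov function for the
transposed error dynamics (`isStable_gain`). -/

namespace URSF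

/-! ### Quadratic forms -/

section QuadraticForm

variable {ι κ : Type*} [Fintype ι] [Fintype κ]

/-- The quadratic form `xᵀ M x`. -/
def quadForm (M : Matrix ι ι ℝ) (x : ι → ℝ) : ℝ := x ⬝ᵥ M *ᵥ x

lemma dotProduct_mulVec_transpose (M : Matrix ι κ ℝ) (x : κ → ℝ) (y : ι → ℝ) :
    x ⬝ᵥ Mᵀ *ᵥ y = (M *ᵥ x) ⬝ᵥ y := by
  rw [mulVec_transpose, dotProduct_comm, ← dotProduct_mulVec, dotProduct_comm]

lemma dotProduct_mulVec_comm {M : Matrix ι ι ℝ} (hM : Mᵀ = M) (x y : ι → ℝ) :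
    x ⬝ᵥ M *ᵥ y = y ⬝ᵥ M *ᵥ x := by
  conv_lhs => rw [← hM]
  rw [dotProduct_mulVec_transpose, dotProduct_comm]

lemma dotProduct_self_nonneg (x : ι → ℝ) : 0 ≤ x ⬝ᵥ x := by
  simpa using dotProduct_star_self_nonneg x

lemma dotProduct_self_pos {x : ι → ℝ} (hx : x ≠ 0) : 0 < x ⬝ᵥ x := by
  simpa using dotProduct_star_self_pos_iff.2 hx

@[simp] lemma quadForm_zero (M : Matrix ι ι ℝ) : quadForm M 0 = 0 := by simp [quadForm]

lemma quadForm_add (M N : Matrix ι ι ℝ) (x : ι → ℝ) :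
    quadForm (M + N) x = quadForm M x + quadForm N x := by
  simp [quadForm, add_mulVec, dotProduct_add]

lemma quadForm_sub (M N : Matrix ι ι ℝ) (x : ι → ℝ) :
    quadForm (M - N) x = quadForm M x - quadForm N x := by
  simp [quadForm, sub_mulVec, dotProduct_sub]

lemma quadForm_smul (c : ℝ) (M : Matrix ι ι ℝ) (x : ι → ℝ) :
    quadForm (c • M) x = c * quadForm M x := by
  simp [quadForm, smul_mulVec, dotProduct_smul]

lemma quadForm_one [DecidableEq ι] (x : ι → ℝ) : quadForm 1 x = x ⬝ᵥ x := by simp [quadForm]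

lemma quadForm_conj (A : Matrix κ ι ℝ) (M : Matrix ι ι ℝ) (x : κ → ℝ) :
    quadForm (A * M * Aᵀ) x = quadForm M (Aᵀ *ᵥ x) := by
  rw [quadForm, quadForm, ← mulVec_mulVec, ← mulVec_mulVec]
  conv_lhs => rw [← transpose_transpose A]
  rw [dotProduct_mulVec_transpose, transpose_transpose]

lemma quadForm_transpose_conj (A : Matrix ι κ ℝ) (M : Matrix ι ι ℝ) (x : κ → ℝ) :
    quadForm (Aᵀ * M * A) x = quadForm M (A *ᵥ x) := by
  simpa using quadForm_conj Aᵀ M x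

lemma quadForm_smul_vec (M : Matrix ι ι ℝ) (c : ℝ) (x : ι → ℝ) :
    quadForm M (c • x) = c ^ 2 * quadForm M x := by
  simp [quadForm, mulVec_smul]; ring

lemma quadForm_add_vec {M : Matrix ι ι ℝ} (hM : Mᵀ = M) (x y : ι → ℝ) :
    quadForm M (x + y) = quadForm M x + 2 * (x ⬝ᵥ M *ᵥ y) + quadForm M y := by
  simp only [quadForm, mulVec_add, add_dotProduct, dotProduct_add]
  rw [dotProduct_mulVec_comm hM y x]; ring

lemma quadForm_sub_vec {M : Matrix ι ι ℝ} (hM : Mᵀ = M) (x y : ι → ℝ) :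
    quadForm M (x - y) = quadForm M x - 2 * (x ⬝ᵥ M *ᵥ y) + quadForm M y := by
  simp only [quadForm, mulVec_sub, sub_dotProduct, dotProduct_sub]
  rw [dotProduct_mulVec_comm hM y x]; ring

lemma posDef_iff {M : Matrix ι ι ℝ} :
    M.PosDef ↔ Mᵀ = M ∧ ∀ x, x ≠ 0 → 0 < quadForm M x := by
  rw [posDef_iff_dotProduct_mulVec, IsHermitian, conjTranspose_eq_transpose_of_trivial]
  simp [quadForm]

lemma posSemidef_iff {M : Matrix ι ι ℝ} :
    M.PosSemidef ↔ Mᵀ = M ∧ ∀ x, 0 ≤ quadForm M x := by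
  rw [posSemidef_iff_dotProduct_mulVec, IsHermitian, conjTranspose_eq_transpose_of_trivial]
  simp [quadForm]

lemma _root_.Matrix.PosDef.transpose_eq {M : Matrix ι ι ℝ} (hM : M.PosDef) : Mᵀ = M :=
  (posDef_iff.1 hM).1

lemma _root_.Matrix.PosDef.quadForm_pos {M : Matrix ι ι ℝ} (hM : M.PosDef) {x : ι → ℝ}
    (hx : x ≠ 0) : 0 < quadForm M x :=
  (posDef_iff.1 hM).2 x hx

lemma _root_.Matrix.PosDef.quadForm_nonneg {M : Matrix ι ι ℝ} (hM : M.PosDef) (x : ι → ℝ) :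
    0 ≤ quadForm M x :=
  (posSemidef_iff.1 hM.posSemidef).2 x

lemma posDef_of_le {M N : Matrix ι ι ℝ} (hM : M.PosDef) (hN : Nᵀ = N)
    (h : ∀ x, quadForm M x ≤ quadForm N x) : N.PosDef :=
  posDef_iff.2 ⟨hN, fun x hx => (hM.quadForm_pos hx).trans_le (h x)⟩

/-! ### Duality between a form and its inverse -/

section Inverse

variable [DecidableEq ι]

lemma _root_.Matrix.PosDef.isUnit_det {M : Matrix ι ι ℝ} (hM : M.PosDef) : IsUnit M.det :=
  (isUnit_iff_isUnit_det _).1 hM.isUnit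

lemma transpose_inv_eq {M : Matrix ι ι ℝ} (hM : Mᵀ = M) : M⁻¹ᵀ = M⁻¹ := by
  rw [transpose_nonsing_inv, hM]

lemma mulVec_inv_mulVec {M : Matrix ι ι ℝ} (hM : IsUnit M.det) (x : ι → ℝ) :
    M *ᵥ M⁻¹ *ᵥ x = x := by
  rw [mulVec_mulVec, mul_nonsing_inv _ hM, one_mulVec]

lemma inv_mulVec_mulVec {M : Matrix ι ι ℝ} (hM : IsUnit M.det) (x : ι → ℝ) :
    M⁻¹ *ᵥ M *ᵥ x = x := by
  rw [mulVec_mulVec, nonsing_inv_mul _ hM, one_mulVec]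

lemma quadForm_inv_mulVec {M : Matrix ι ι ℝ} (hM : IsUnit M.det) (x : ι → ℝ) :
    quadForm M (M⁻¹ *ᵥ x) = quadForm M⁻¹ x := by
  rw [quadForm, mulVec_inv_mulVec hM, dotProduct_comm, quadForm]

lemma quadForm_mulVec_self {M : Matrix ι ι ℝ} (hM : IsUnit M.det) (x : ι → ℝ) :
    quadForm M⁻¹ (M *ᵥ x) = quadForm M x := by
  rw [quadForm, inv_mulVec_mulVec hM, dotProduct_comm, quadForm]

/-- Young's inequality for a positive definite form and its dual. -/
lemma two_mul_dotProduct_le {M : Matrix ι ι ℝ} (hM : M.PosDef) (x y : ι → ℝ) :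
    2 * (x ⬝ᵥ y) ≤ quadForm M⁻¹ x + quadForm M y := by
  have h := hM.quadForm_nonneg (M⁻¹ *ᵥ x - y)
  rw [quadForm_sub_vec hM.transpose_eq] at h
  have h1 := quadForm_inv_mulVec hM.isUnit_det x
  have h2 : (M⁻¹ *ᵥ x) ⬝ᵥ M *ᵥ y = x ⬝ᵥ y := by
    rw [dotProduct_mulVec_comm hM.transpose_eq, mulVec_inv_mulVec hM.isUnit_det,
      dotProduct_comm]
  linarith

/-- The equality case of Young's inequality: `M⁻¹ x` maximizes `2 x·y - M(y)` over `y`. -/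
lemma quadForm_inv_eq {M : Matrix ι ι ℝ} (hM : M.PosDef) (x : ι → ℝ) :
    quadForm M⁻¹ x = 2 * (x ⬝ᵥ M⁻¹ *ᵥ x) - quadForm M (M⁻¹ *ᵥ x) := by
  rw [quadForm_inv_mulVec hM.isUnit_det, quadForm]; ring

lemma quadForm_inv_le {M N : Matrix ι ι ℝ} (hM : M.PosDef) (hN : N.PosDef)
    (h : ∀ x, quadForm M x ≤ quadForm N x) (x : ι → ℝ) : quadForm N⁻¹ x ≤ quadForm M⁻¹ x := by
  have h1 := two_mul_dotProduct_le hM x (N⁻¹ *ᵥ x)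
  have h2 := quadForm_inv_eq hN x
  have h3 := h (N⁻¹ *ᵥ x)
  linarith

end Inverse

/-! ### Extreme eigenvalues -/

section Eigenvalues

variable [DecidableEq ι]

lemma spectrum_nonempty [Nonempty ι] {M : Matrix ι ι ℝ} (hM : M.IsHermitian) :
    (spectrum ℝ M).Nonempty :=
  hM.spectrum_real_eq_range_eigenvalues ▸ Set.range_nonempty _

lemma sigmaMin_mul_le {M : Matrix ι ι ℝ} (hM : M.IsHermitian) (x : ι → ℝ) :
    sigmaMin M * (x ⬝ᵥ x) ≤ quadForm M x := by
  have h : (M - sigmaMin M • (1 : Matrix ι ι ℝ)).PosSemidef := by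
    rw [posSemidef_iff_isHermitian_and_spectrum_nonneg]
    refine ⟨hM.sub ?_, ?_⟩
    · simp [IsHermitian, conjTranspose_eq_transpose_of_trivial]
    · rw [← Algebra.algebraMap_eq_smul_one, ← spectrum.sub_singleton_eq]
      rintro _ ⟨a, ha, b, rfl, rfl⟩
      have := csInf_le (Matrix.finite_spectrum M).bddBelow ha
      simpa [sigmaMin] using this
  have := (posSemidef_iff.1 h).2 x
  rw [quadForm_sub, quadForm_smul, quadForm_one] at this
  linarith

lemma le_sigmaMax_mul {M : Matrix ι ι ℝ} (hM : M.IsHermitian) (x : ι → ℝ) :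
    quadForm M x ≤ sigmaMax M * (x ⬝ᵥ x) := by
  have h : (sigmaMax M • (1 : Matrix ι ι ℝ) - M).PosSemidef := by
    rw [posSemidef_iff_isHermitian_and_spectrum_nonneg]
    refine ⟨IsHermitian.sub ?_ hM, ?_⟩
    · simp [IsHermitian, conjTranspose_eq_transpose_of_trivial]
    · rw [← Algebra.algebraMap_eq_smul_one, ← spectrum.singleton_sub_eq]
      rintro _ ⟨b, rfl, a, ha, rfl⟩
      have := le_csSup (Matrix.finite_spectrum M).bddAbove ha
      simpa [sigmaMax] using this
  have := (posSemidef_iff.1 h).2 x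
  rw [quadForm_sub, quadForm_smul, quadForm_one] at this
  linarith

lemma sigmaMin_pos [Nonempty ι] {M : Matrix ι ι ℝ} (hM : M.PosDef) : 0 < sigmaMin M := by
  have h : sigmaMin M ∈ spectrum ℝ M :=
    (spectrum_nonempty hM.isHermitian).csInf_mem (Matrix.finite_spectrum M)
  rw [hM.isHermitian.spectrum_real_eq_range_eigenvalues] at h
  obtain ⟨i, hi⟩ := h
  rw [← hi]
  exact hM.eigenvalues_pos i

lemma exists_pos_mul_le [Nonempty ι] {M : Matrix ι ι ℝ} (hM : M.PosDef) :
    ∃ c : ℝ, 0 < c ∧ ∀ x, c * (x ⬝ᵥ x) ≤ quadForm M x :=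
  ⟨_, sigmaMin_pos hM, sigmaMin_mul_le hM.isHermitian⟩

lemma exists_le_mul {M : Matrix ι ι ℝ} (hM : Mᵀ = M) :
    ∃ d : ℝ, 0 < d ∧ ∀ x, quadForm M x ≤ d * (x ⬝ᵥ x) := by
  refine ⟨max 1 (sigmaMax M), by positivity, fun x => ?_⟩
  have hH : M.IsHermitian := by rwa [IsHermitian, conjTranspose_eq_transpose_of_trivial]
  exact (le_sigmaMax_mul hH x).trans
    (mul_le_mul_of_nonneg_right (le_max_right _ _) (dotProduct_self_nonneg x))

end Eigenvalues

/-! ### Convergence of symmetric matrices -/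

section Convergence

lemma tendsto_matrix {ι κ α : Type*} {l : Filter α} {f : α → Matrix ι κ ℝ} {M : Matrix ι κ ℝ} :
    Tendsto f l (𝓝 M) ↔ ∀ i j, Tendsto (fun t => f t i j) l (𝓝 (M i j)) := by
  exact tendsto_pi_nhds.trans (forall_congr' fun _ => tendsto_pi_nhds)

lemma tendsto_quadForm {α : Type*} {l : Filter α} {f : α → Matrix ι ι ℝ} {M : Matrix ι ι ℝ}
    (h : Tendsto f l (𝓝 M)) (x : ι → ℝ) :
    Tendsto (fun t => quadForm (f t) x) l (𝓝 (quadForm M x)) := by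
  have : Continuous fun M : Matrix ι ι ℝ => quadForm M x := by
    unfold quadForm
    fun_prop
  exact (this.tendsto M).comp h

variable [DecidableEq ι]

lemma apply_eq_quadForm {M : Matrix ι ι ℝ} (hM : Mᵀ = M) (i j : ι) :
    M i j = (quadForm M (Pi.single i 1 + Pi.single j 1) -
      quadForm M (Pi.single i 1 - Pi.single j 1)) / 4 := by
  have h : (Pi.single i 1 : ι → ℝ) ⬝ᵥ M *ᵥ Pi.single j 1 = M i j := by simp
  rw [quadForm_add_vec hM, quadForm_sub_vec hM, h]; ring

lemma tendsto_of_tendsto_quadForm {α : Type*} {l : Filter α} {f : α → Matrix ι ι ℝ}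
    {M : Matrix ι ι ℝ} (hf : ∀ t, (f t)ᵀ = f t) (hM : Mᵀ = M)
    (h : ∀ x, Tendsto (fun t => quadForm (f t) x) l (𝓝 (quadForm M x))) :
    Tendsto f l (𝓝 M) := by
  rw [tendsto_matrix]
  intro i j
  rw [apply_eq_quadForm hM]
  simp_rw [fun t => apply_eq_quadForm (hf t) i j]
  exact ((h _).sub (h _)).div_const 4

/-- A sequence of symmetric matrices converges if its quadratic forms converge. -/
lemma exists_tendsto_of_quadForm {f : ℕ → Matrix ι ι ℝ} (hf : ∀ t, (f t)ᵀ = f t)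
    (h : ∀ x, ∃ a, Tendsto (fun t => quadForm (f t) x) atTop (𝓝 a)) :
    ∃ M : Matrix ι ι ℝ, Mᵀ = M ∧ Tendsto f atTop (𝓝 M) := by
  choose a ha using h
  have key : ∀ i j, Tendsto (fun t => f t i j) atTop
      (𝓝 ((a (Pi.single i 1 + Pi.single j 1) - a (Pi.single i 1 - Pi.single j 1)) / 4)) := by
    intro i j
    simp_rw [fun t => apply_eq_quadForm (hf t) i j]
    exact ((ha _).sub (ha _)).div_const 4
  have hlim : Tendsto f atTop (𝓝 (Matrix.of fun i j =>
      (a (Pi.single i 1 + Pi.single j 1) - a (Pi.single i 1 - Pi.single j 1)) / 4)) :=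
    tendsto_matrix.2 key
  refine ⟨_, ?_, hlim⟩
  ext i j
  refine tendsto_nhds_unique (key j i) ((key i j).congr fun t => ?_)
  conv_lhs => rw [← hf t]
  rfl

lemma tendsto_inv {α : Type*} {l : Filter α} {f : α → Matrix ι ι ℝ} {M : Matrix ι ι ℝ}
    (hM : IsUnit M.det) (h : Tendsto f l (𝓝 M)) : Tendsto (fun t => (f t)⁻¹) l (𝓝 M⁻¹) := by
  have h1 : ContinuousAt Ring.inverse M.det := by
    have := continuousAt_inv₀ hM.ne_zero
    simpa [Ring.inverse_eq_inv'] using this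
  exact (continuousAt_matrix_inv M h1).tendsto.comp h

end Convergence

/-! ### Powers of matrices -/

section Powers

variable [DecidableEq ι]

/-- Lyapunov's criterion. -/
lemma tendsto_pow_of_lyapunov {X N : Matrix ι ι ℝ} (hX : X.PosDef)
    (h : ∀ x, x ≠ 0 → quadForm X (N *ᵥ x) < quadForm X x) :
    Tendsto (fun j => N ^ j) atTop (𝓝 0) := by
  cases isEmpty_or_nonempty ι
  · exact tendsto_const_nhds.congr fun j => Subsingleton.elim _ _
  have hY : (X - Nᵀ * X * N).PosDef := by
    rw [posDef_iff]
    constructor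
    · simp [transpose_mul, hX.transpose_eq, Matrix.mul_assoc]
    · intro x hx
      rw [quadForm_sub, quadForm_transpose_conj]
      linarith [h x hx]
  obtain ⟨c, hc, hcY⟩ := exists_pos_mul_le hY
  obtain ⟨c', hc', hcX⟩ := exists_pos_mul_le hX
  obtain ⟨d, hd, hdX⟩ := exists_le_mul hX.transpose_eq
  -- One step loses at least `c |x|²`, which is at least `c / d` times the form of `X`. Truncation
  -- at `0` makes the factor iterable without comparing `c` and `d`.
  have step : ∀ x, quadForm X (N *ᵥ x) ≤ max 0 (1 - c / d) * quadForm X x := by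
    intro x
    have h1 := hcY x
    rw [quadForm_sub, quadForm_transpose_conj] at h1
    have h2 : c / d * quadForm X x ≤ c * (x ⬝ᵥ x) := by
      rw [div_mul_eq_mul_div, div_le_iff₀ hd]
      nlinarith [hdX x]
    have h3 := mul_le_mul_of_nonneg_right (le_max_right 0 (1 - c / d)) (hX.quadForm_nonneg x)
    linarith
  set γ := max 0 (1 - c / d) with hγ
  have hγ0 : 0 ≤ γ := le_max_left _ _
  have hγ1 : γ < 1 := max_lt one_pos (by linarith [div_pos hc hd])
  have iter : ∀ j x, quadForm X (N ^ j *ᵥ x) ≤ γ ^ j * quadForm X x := by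
    intro j x
    induction j with
    | zero => simp
    | succ j ih =>
      rw [pow_succ', ← mulVec_mulVec, pow_succ', mul_assoc]
      exact (step _).trans (mul_le_mul_of_nonneg_left ih hγ0)
  rw [tendsto_matrix]
  intro i j
  have hb : ∀ t : ℕ, (N ^ t) i j ^ 2 ≤ γ ^ t * (quadForm X (Pi.single j 1) / c') := by
    intro t
    have h1 := iter t (Pi.single j 1)
    have h2 := hcX (N ^ t *ᵥ Pi.single j 1)
    have h3 : (N ^ t) i j ^ 2 ≤ (N ^ t *ᵥ Pi.single j 1) ⬝ᵥ (N ^ t *ᵥ Pi.single j 1) := by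
      have : ∀ v : ι → ℝ, v i ^ 2 ≤ v ⬝ᵥ v := fun v => by
        rw [sq]
        exact Finset.single_le_sum (f := fun i => v i * v i)
          (fun i _ => mul_self_nonneg (v i)) (Finset.mem_univ i)
      simpa using this (N ^ t *ᵥ Pi.single j 1)
    rw [mul_div_assoc', le_div_iff₀ hc']
    nlinarith
  have hlim : Tendsto (fun t => (N ^ t) i j ^ 2) atTop (𝓝 0) := by
    refine squeeze_zero (fun t => sq_nonneg _) hb ?_
    simpa using (tendsto_pow_atTop_nhds_zero_of_lt_one hγ0 hγ1).mul_const
      (quadForm X (Pi.single j 1) / c')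
  have h2 := hlim.sqrt
  simp only [Real.sqrt_sq_eq_abs, Real.sqrt_zero] at h2
  exact (tendsto_zero_iff_abs_tendsto_zero _).2 h2

/-- On a complex eigenvector the powers act as `z ^ j`, so a nonzero coordinate of it forces `z ^ j
→ 0`. -/
lemma isStable_of_tendsto_pow {N : Matrix ι ι ℝ} (h : Tendsto (fun j => N ^ j) atTop (𝓝 0)) :
    IsStable N := by
  intro z hz
  rw [← spectrum_toLin', ← Module.End.hasEigenvalue_iff_mem_spectrum] at hz
  obtain ⟨v, hv⟩ := hz.exists_hasEigenvector
  have hpow : ∀ j : ℕ, ((N ^ j).map (algebraMap ℝ ℂ)) *ᵥ v = z ^ j • v := by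
    intro j
    rw [Matrix.map_pow]
    have := hv.pow_apply j
    rwa [← toLin'_pow, toLin'_apply] at this
  obtain ⟨i, hi⟩ := Function.ne_iff.1 hv.2
  have hlim : Tendsto (fun j : ℕ => z ^ j * v i) atTop (𝓝 0) := by
    have h1 : Tendsto (fun j : ℕ => (((N ^ j).map (algebraMap ℝ ℂ)) *ᵥ v) i) atTop
        (𝓝 ((((0 : Matrix ι ι ℝ).map (algebraMap ℝ ℂ)) *ᵥ v) i)) := by
      have hc : Continuous fun M : Matrix ι ι ℝ => ((M.map (algebraMap ℝ ℂ)) *ᵥ v) i := by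
        unfold mulVec dotProduct
        simp only [map_apply, Complex.coe_algebraMap]
        fun_prop
      exact (hc.tendsto _).comp h
    simp only [hpow] at h1
    simpa using h1
  have h2 : Tendsto (fun j : ℕ => z ^ j) atTop (𝓝 0) := by
    have := hlim.mul_const (v i)⁻¹
    simpa [mul_assoc, mul_inv_cancel₀ hi] using this
  exact tendsto_pow_atTop_nhds_zero_iff_norm_lt_one.1 h2

/-- Iteration gives `Z = M ^ j Z N ^ j`. Both uniqueness claims, for the Lyapunov and the Riccati
equation, reduce to this. -/
lemma eq_zero_of_eq_mul_mul {M N Z : Matrix ι ι ℝ} (hM : Tendsto (fun j => M ^ j) atTop (𝓝 0))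
    (hN : Tendsto (fun j => N ^ j) atTop (𝓝 0)) (h : Z = M * Z * N) : Z = 0 := by
  have key : ∀ j : ℕ, Z = M ^ j * Z * N ^ j := by
    intro j
    induction j with
    | zero => simp
    | succ j ih =>
      calc Z = M ^ j * (M * Z * N) * N ^ j := by rw [← h]; exact ih
        _ = _ := by rw [pow_succ M, pow_succ' N]; simp only [Matrix.mul_assoc]
  have hlim : Tendsto (fun j : ℕ => M ^ j * Z * N ^ j) atTop (𝓝 (0 * Z * 0)) :=
    (hM.mul tendsto_const_nhds).mul hN
  simp only [← key, Matrix.mul_zero] at hlim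
  exact tendsto_nhds_unique tendsto_const_nhds hlim

end Powers

/-! ### Decay of powers from the spectral radius -/

section SpectralRadius

variable [DecidableEq ι]

attribute [local instance] Matrix.linftyOpNormedRing Matrix.linftyOpNormedAlgebra

/-- By Gelfand's formula the norm of `N ^ j` is eventually below `c ^ j` for some `c < 1 / ρ`; the
row sum norm dominates every entry. -/
lemma tendsto_pow_of_maxModulus_lt {N : Matrix ι ι ℝ} {ρ : ℝ} (hρ : 0 < ρ)
    (h : ENNReal.ofReal ρ < (maxModulus N)⁻¹) :
    Tendsto (fun j => (ρ • N) ^ j) atTop (𝓝 0) := by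
  have h1 : spectralRadius ℂ (N.map (algebraMap ℝ ℂ)) < (ENNReal.ofReal ρ)⁻¹ := by
    rwa [← ENNReal.lt_inv_iff_lt_inv]
  obtain ⟨c, hc1, hc2⟩ := ENNReal.lt_iff_exists_nnreal_btwn.1 h1
  have hq : ρ * c < 1 := by
    have : (c : ℝ≥0∞) * ENNReal.ofReal ρ < 1 := by
      rw [← ENNReal.lt_div_iff_mul_lt (by simp [hρ]) (by simp)]
      simpa using hc2
    rw [← ENNReal.ofReal_coe_nnreal, ← ENNReal.ofReal_mul c.coe_nonneg,
      ENNReal.ofReal_lt_one] at this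
    linarith [mul_comm ρ (c : ℝ)]
  have h2 := (spectrum.pow_nnnorm_pow_one_div_tendsto_nhds_spectralRadius
    (N.map (algebraMap ℝ ℂ))).eventually_lt_const hc1
  have h3 : ∀ᶠ j : ℕ in atTop, ∀ a b, |((ρ • N) ^ j) a b| ≤ (ρ * c) ^ j := by
    filter_upwards [h2, eventually_gt_atTop 0] with j hj hj0 a b
    have hj' : (‖(N.map (algebraMap ℝ ℂ)) ^ j‖₊ : ℝ≥0∞) < (c : ℝ≥0∞) ^ j := by
      have := ENNReal.pow_lt_pow_left hj0.ne' hj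
      rwa [← ENNReal.rpow_natCast (_ ^ _), ← ENNReal.rpow_mul, one_div,
        inv_mul_cancel₀ (by positivity), ENNReal.rpow_one] at this
    have hnorm : ‖(N.map (algebraMap ℝ ℂ)) ^ j‖ ≤ (c : ℝ) ^ j := by
      have : ‖(N.map (algebraMap ℝ ℂ)) ^ j‖₊ < c ^ j := by exact_mod_cast hj'
      exact_mod_cast this.le
    have hentry : |(N ^ j) a b| ≤ ‖(N.map (algebraMap ℝ ℂ)) ^ j‖ := by
      rw [← Matrix.map_pow, Matrix.linfty_opNorm_def]
      have e1 : ‖((N ^ j).map (algebraMap ℝ ℂ)) a b‖₊ ≤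
          ∑ b, ‖((N ^ j).map (algebraMap ℝ ℂ)) a b‖₊ :=
        Finset.single_le_sum (f := fun b => ‖((N ^ j).map (algebraMap ℝ ℂ)) a b‖₊)
          (fun _ _ => zero_le) (Finset.mem_univ b)
      have e2 := Finset.le_sup (f := fun a => ∑ b, ‖((N ^ j).map (algebraMap ℝ ℂ)) a b‖₊)
        (Finset.mem_univ a)
      have e3 : ‖((N ^ j).map (algebraMap ℝ ℂ)) a b‖ = |(N ^ j) a b| := by simp
      rw [← e3]
      exact_mod_cast e1.trans e2
    rw [smul_pow, Matrix.smul_apply, smul_eq_mul, abs_mul, abs_of_nonneg (by positivity), mul_pow]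
    exact mul_le_mul_of_nonneg_left (hentry.trans hnorm) (by positivity)
  rw [tendsto_matrix]
  intro a b
  refine squeeze_zero_norm' (h3.mono fun j hj => hj a b) ?_
  exact tendsto_pow_atTop_nhds_zero_of_lt_one (by positivity) hq

end SpectralRadius

end QuadraticForm

end URSF

namespace URSF

/-! ### The discrete Lyapunov equation -/

section DiscreteLyapunov

variable {ι : Type*} [Fintype ι] [DecidableEq ι]

lemma tendsto_transpose_pow {M : Matrix ι ι ℝ} (hM : Tendsto (fun j => M ^ j) atTop (𝓝 0)) :
    Tendsto (fun j => Mᵀ ^ j) atTop (𝓝 0) := by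
  have h : Continuous fun M : Matrix ι ι ℝ => Mᵀ := continuous_id.matrix_transpose
  simpa [Function.comp_def, transpose_pow] using (h.tendsto 0).comp hM

/-- The linear map `X ↦ X - M X Mᵀ` is injective by iteration, hence surjective in finite dimension.
-/
lemma existsUnique_lyapunov {M : Matrix ι ι ℝ} (hM : Tendsto (fun j => M ^ j) atTop (𝓝 0))
    (W : Matrix ι ι ℝ) : ∃ S, ∀ X, X = M * X * Mᵀ + W ↔ X = S := by
  let T : Matrix ι ι ℝ →ₗ[ℝ] Matrix ι ι ℝ :=
    { toFun := fun X => X - M * X * Mᵀ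
      map_add' := fun X Y => by simp only [Matrix.mul_add, Matrix.add_mul]; abel
      map_smul' := fun c X => by simp [smul_sub] }
  have hT : Function.Injective T := by
    rw [← LinearMap.ker_eq_bot, LinearMap.ker_eq_bot']
    intro X hX
    exact eq_zero_of_eq_mul_mul hM (tendsto_transpose_pow hM) (sub_eq_zero.1 hX)
  obtain ⟨S, hS⟩ := LinearMap.injective_iff_surjective.1 hT W
  have key : ∀ X, X = M * X * Mᵀ + W ↔ T X = W := fun X => by
    rw [← sub_eq_iff_eq_add']; rfl
  refine ⟨S, fun X => ?_⟩
  rw [key, ← hS]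
  exact hT.eq_iff

/-- Symmetry follows from uniqueness, as `Xᵀ` solves the same equation. The form of `X` does not
increase along the powers of `Mᵀ` and tends to zero there, so it is nonnegative; `W` makes it
strictly positive. -/
lemma posDef_of_lyapunov {M W X : Matrix ι ι ℝ} (hM : Tendsto (fun j => M ^ j) atTop (𝓝 0))
    (hW : W.PosDef) (hX : X = M * X * Mᵀ + W) : X.PosDef := by
  have hsymm : Xᵀ = X := by
    obtain ⟨S, hS⟩ := existsUnique_lyapunov hM W
    rw [(hS X).1 hX]
    refine (hS _).1 ?_
    have h := congrArg transpose ((hS S).2 rfl)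
    rw [transpose_add, hW.transpose_eq, transpose_mul, transpose_mul, transpose_transpose,
      ← Matrix.mul_assoc] at h
    exact h
  have hstep : ∀ x, quadForm X x = quadForm X (Mᵀ *ᵥ x) + quadForm W x := fun x => by
    conv_lhs => rw [hX]
    rw [quadForm_add, quadForm_conj]
  have hpow : ∀ (j : ℕ) x, quadForm X (Mᵀ ^ j *ᵥ x) ≤ quadForm X x := by
    intro j x
    induction j with
    | zero => simp
    | succ j ih =>
      rw [pow_succ', ← mulVec_mulVec]
      linarith [hstep (Mᵀ ^ j *ᵥ x), hW.quadForm_nonneg (Mᵀ ^ j *ᵥ x)]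
  have hnonneg : ∀ x, 0 ≤ quadForm X x := by
    intro x
    have hc : Continuous fun N : Matrix ι ι ℝ => quadForm X (N *ᵥ x) := by
      unfold quadForm
      fun_prop
    have hlim := (hc.tendsto 0).comp (tendsto_transpose_pow hM)
    simp only [zero_mulVec, quadForm_zero] at hlim
    exact le_of_tendsto' hlim fun j => hpow j x
  refine posDef_iff.2 ⟨hsymm, fun x hx => ?_⟩
  rw [hstep]
  linarith [hnonneg (Mᵀ *ᵥ x), hW.quadForm_pos hx]

end DiscreteLyapunov

/-! ### Monotonicity and invariance for the Riccati recursion -/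

section Monotone

variable {n m : ℕ} {A : Matrix (Fin n) (Fin n) ℝ} {C : Matrix (Fin m) (Fin n) ℝ}
  {Q : Matrix (Fin n) (Fin n) ℝ} {R : Matrix (Fin m) (Fin m) ℝ} {θ : ℝ}

lemma posDef_mul_mul_transpose_add {ι κ : Type*} [Fintype ι] [Fintype κ] {M : Matrix κ κ ℝ}
    {N : Matrix ι ι ℝ} (hM : M.PosDef) (hN : N.PosDef) (A : Matrix ι κ ℝ) :
    (A * M * Aᵀ + N).PosDef := by
  refine posDef_of_le hN ?_ fun x => ?_
  · simp [transpose_mul, hM.transpose_eq, hN.transpose_eq, Matrix.mul_assoc]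
  · rw [quadForm_add, quadForm_conj]
    linarith [hM.quadForm_nonneg (Aᵀ *ᵥ x)]

lemma lyapunovEq_iff {G : Matrix (Fin n) (Fin m) ℝ} {ρ α : ℝ} {X : Matrix (Fin n) (Fin n) ℝ} :
    LyapunovEq A C Q R G ρ α X ↔
      X = (ρ • (A - α • (G * C))) * X * (ρ • (A - α • (G * C)))ᵀ + (G * R * Gᵀ + Q) := by
  rw [LyapunovEq, transpose_smul, Matrix.smul_mul, Matrix.smul_mul, Matrix.mul_smul, smul_smul,
    ← sq, add_assoc]

lemma quadForm_invV (P : Matrix (Fin n) (Fin n) ℝ) (x : Fin n → ℝ) :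
    quadForm (invV C R θ P) x = quadForm P⁻¹ x + quadForm R⁻¹ (C *ᵥ x) - θ * (x ⬝ᵥ x) := by
  rw [invV, quadForm_sub, quadForm_add, quadForm_transpose_conj, quadForm_smul, quadForm_one]

lemma transpose_invV (hR : R.PosDef) {P : Matrix (Fin n) (Fin n) ℝ} (hP : Pᵀ = P) :
    (invV C R θ P)ᵀ = invV C R θ P := by
  simp [invV, transpose_inv_eq hP, transpose_inv_eq hR.transpose_eq, Matrix.mul_assoc]

lemma quadForm_riccati (P : Matrix (Fin n) (Fin n) ℝ) (x : Fin n → ℝ) :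
    quadForm (riccati A C Q R θ P) x = quadForm (invV C R θ P)⁻¹ (Aᵀ *ᵥ x) + quadForm Q x := by
  rw [riccati, quadForm_add, quadForm_conj]

/-- Inversion is antitone, so the condition at the top of an order interval holds throughout it. -/
lemma posDef_invV_of_le (hR : R.PosDef) {P P' : Matrix (Fin n) (Fin n) ℝ} (hP : P.PosDef)
    (hP' : P'.PosDef) (hV : (invV C R θ P').PosDef) (h : ∀ x, quadForm P x ≤ quadForm P' x) :
    (invV C R θ P).PosDef := by
  refine posDef_of_le hV (transpose_invV hR hP.transpose_eq) fun x => ?_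
  rw [quadForm_invV, quadForm_invV]
  linarith [quadForm_inv_le hP hP' h x]

lemma riccati_posDef (hQ : Q.PosDef) {P : Matrix (Fin n) (Fin n) ℝ}
    (hV : (invV C R θ P).PosDef) : (riccati A C Q R θ P).PosDef :=
  posDef_mul_mul_transpose_add hV.inv hQ A

lemma le_riccati {P : Matrix (Fin n) (Fin n) ℝ} (hV : (invV C R θ P).PosDef) (x : Fin n → ℝ) :
    quadForm Q x ≤ quadForm (riccati A C Q R θ P) x := by
  rw [quadForm_riccati]
  linarith [hV.inv.quadForm_nonneg (Aᵀ *ᵥ x)]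

lemma riccati_mono (hR : R.PosDef) {P P' : Matrix (Fin n) (Fin n) ℝ} (hP : P.PosDef)
    (hP' : P'.PosDef) (hV : (invV C R θ P').PosDef) (h : ∀ x, quadForm P x ≤ quadForm P' x)
    (x : Fin n → ℝ) :
    quadForm (riccati A C Q R θ P) x ≤ quadForm (riccati A C Q R θ P') x := by
  rw [quadForm_riccati, quadForm_riccati]
  refine add_le_add_left (quadForm_inv_le hV (posDef_invV_of_le hR hP hP' hV h) (fun y => ?_) _) _
  rw [quadForm_invV, quadForm_invV]
  linarith [quadForm_inv_le hP hP' h y]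

lemma tendsto_invV {f : ℕ → Matrix (Fin n) (Fin n) ℝ} {P : Matrix (Fin n) (Fin n) ℝ}
    (hP : P.PosDef) (h : Tendsto f atTop (𝓝 P)) :
    Tendsto (fun t => invV C R θ (f t)) atTop (𝓝 (invV C R θ P)) := by
  unfold invV
  exact ((tendsto_inv hP.isUnit_det h).add tendsto_const_nhds).sub tendsto_const_nhds

lemma tendsto_riccati {f : ℕ → Matrix (Fin n) (Fin n) ℝ} {P : Matrix (Fin n) (Fin n) ℝ}
    (hP : P.PosDef) (hV : (invV C R θ P).PosDef) (h : Tendsto f atTop (𝓝 P)) :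
    Tendsto (fun t => riccati A C Q R θ (f t)) atTop (𝓝 (riccati A C Q R θ P)) := by
  unfold riccati
  exact ((tendsto_const_nhds.mul (tendsto_inv hV.isUnit_det (tendsto_invV hP h))).mul
    tendsto_const_nhds).add tendsto_const_nhds

lemma tendsto_gain (hR : R.PosDef) {f : ℕ → Matrix (Fin n) (Fin n) ℝ}
    {P : Matrix (Fin n) (Fin n) ℝ} (hP : P.PosDef) (h : Tendsto f atTop (𝓝 P)) :
    Tendsto (fun t => gain C R (f t)) atTop (𝓝 (gain C R P)) := by
  have hc1 : Continuous fun P : Matrix (Fin n) (Fin n) ℝ => P * Cᵀ := by fun_prop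
  have hc2 : Continuous fun P : Matrix (Fin n) (Fin n) ℝ => C * P * Cᵀ + R := by fun_prop
  have h1 := (hc1.tendsto P).comp h
  have h2 := tendsto_inv (posDef_mul_mul_transpose_add hP hR C).isUnit_det ((hc2.tendsto P).comp h)
  have hc3 : Continuous fun p : Matrix (Fin n) (Fin m) ℝ × Matrix (Fin m) (Fin m) ℝ =>
      p.1 * p.2 := continuous_fst.matrix_mul continuous_snd
  exact (hc3.tendsto _).comp (h1.prodMk_nhds h2)

/-- Monotonicity in the initial value thereby becomes monotonicity in time. -/
lemma riccatiSeq_succ' (P : Matrix (Fin n) (Fin n) ℝ) (t : ℕ) :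
    riccatiSeq A C Q R θ P (t + 1) = riccatiSeq A C Q R θ (riccati A C Q R θ P) t := by
  induction t with
  | zero => rfl
  | succ t ih => rw [riccatiSeq, ih, riccatiSeq]

/-- The order interval below a supersolution of the Riccati equation is invariant. -/
lemma riccatiSeq_mem (hQ : Q.PosDef) (hR : R.PosDef) {S : Matrix (Fin n) (Fin n) ℝ}
    (hS : S.PosDef) (hV : (invV C R θ S).PosDef)
    (hle : ∀ x, quadForm (riccati A C Q R θ S) x ≤ quadForm S x)
    {P : Matrix (Fin n) (Fin n) ℝ} (hP : P.PosDef) (hPS : ∀ x, quadForm P x ≤ quadForm S x)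
    (t : ℕ) : (riccatiSeq A C Q R θ P t).PosDef ∧
      ∀ x, quadForm (riccatiSeq A C Q R θ P t) x ≤ quadForm S x := by
  induction t with
  | zero => exact ⟨hP, hPS⟩
  | succ t ih =>
    refine ⟨riccati_posDef hQ (posDef_invV_of_le hR ih.1 hS hV ih.2), fun x => ?_⟩
    exact (riccati_mono hR ih.1 hS hV ih.2 x).trans (hle x)

lemma riccatiSeq_mono (hQ : Q.PosDef) (hR : R.PosDef) {S : Matrix (Fin n) (Fin n) ℝ}
    (hS : S.PosDef) (hV : (invV C R θ S).PosDef)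
    (hle : ∀ x, quadForm (riccati A C Q R θ S) x ≤ quadForm S x)
    {P P' : Matrix (Fin n) (Fin n) ℝ} (hP : P.PosDef) (hP' : P'.PosDef)
    (h : ∀ x, quadForm P x ≤ quadForm P' x) (hPS : ∀ x, quadForm P' x ≤ quadForm S x)
    (t : ℕ) (x : Fin n → ℝ) :
    quadForm (riccatiSeq A C Q R θ P t) x ≤ quadForm (riccatiSeq A C Q R θ P' t) x := by
  induction t generalizing x with
  | zero => exact h x
  | succ t ih =>
    have h1 := riccatiSeq_mem hQ hR hS hV hle hP (fun x => (h x).trans (hPS x)) t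
    have h2 := riccatiSeq_mem hQ hR hS hV hle hP' hPS t
    exact riccati_mono hR h1.1 h2.1 (posDef_invV_of_le hR h2.1 hS hV h2.2) ih x

/-- A limit of the recursion in the order interval is a fixed point. -/
lemma riccati_eq_of_tendsto (hQ : Q.PosDef) (hR : R.PosDef) {S : Matrix (Fin n) (Fin n) ℝ}
    (hS : S.PosDef) (hV : (invV C R θ S).PosDef)
    (hle : ∀ x, quadForm (riccati A C Q R θ S) x ≤ quadForm S x)
    {P₀ P : Matrix (Fin n) (Fin n) ℝ} (hP₀ : P₀.PosDef)
    (hPS : ∀ x, quadForm P₀ x ≤ quadForm S x) (hP : Pᵀ = P)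
    (hlim : Tendsto (riccatiSeq A C Q R θ P₀) atTop (𝓝 P)) :
    P.PosDef ∧ (invV C R θ P).PosDef ∧ riccati A C Q R θ P = P := by
  have hmem := riccatiSeq_mem hQ hR hS hV hle hP₀ hPS
  have hlim1 := (tendsto_add_atTop_iff_nat 1).2 hlim
  -- All iterates from index 1 on dominate `Q`, so definiteness survives the limit.
  have hpd : P.PosDef := by
    refine posDef_of_le hQ hP fun x => ge_of_tendsto' (tendsto_quadForm hlim1 x) fun t => ?_
    exact le_riccati (posDef_invV_of_le hR (hmem t).1 hS hV (hmem t).2) x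
  have hPV : (invV C R θ P).PosDef :=
    posDef_invV_of_le hR hpd hS hV fun x =>
      le_of_tendsto' (tendsto_quadForm hlim x) fun t => (hmem t).2 x
  exact ⟨hpd, hPV, tendsto_nhds_unique (tendsto_riccati hpd hPV hlim) hlim1⟩

/-- If the Riccati equation has at most one positive definite solution, the recursion converges
to it from every initial value below a supersolution. -/
theorem exists_tendsto_riccatiSeq (hQ : Q.PosDef) (hR : R.PosDef)
    {S : Matrix (Fin n) (Fin n) ℝ} (hS : S.PosDef) (hV : (invV C R θ S).PosDef)
    (hle : ∀ x, quadForm (riccati A C Q R θ S) x ≤ quadForm S x)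
    (huniq : ∀ P P' : Matrix (Fin n) (Fin n) ℝ, P.PosDef → P'.PosDef →
      (invV C R θ P).PosDef → (invV C R θ P').PosDef →
      riccati A C Q R θ P = P → riccati A C Q R θ P' = P' → P = P') :
    ∃ P : Matrix (Fin n) (Fin n) ℝ, (P.PosDef ∧ (invV C R θ P).PosDef ∧
        riccati A C Q R θ P = P) ∧
      ∀ P₀ : Matrix (Fin n) (Fin n) ℝ, P₀.PosDef → (∀ x, quadForm P₀ x ≤ quadForm S x) →
        Tendsto (riccatiSeq A C Q R θ P₀) atTop (𝓝 P) := by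
  have hQS : ∀ x, quadForm Q x ≤ quadForm S x := fun x => (le_riccati hV x).trans (hle x)
  have hQV := posDef_invV_of_le hR hQ hS hV hQS
  have hrQ := riccati_posDef (A := A) hQ hQV
  have hrS := riccati_posDef (A := A) hQ hV
  have memS := riccatiSeq_mem hQ hR hS hV hle hS fun _ => le_rfl
  have memQ := riccatiSeq_mem hQ hR hS hV hle hQ hQS
  have hanti : ∀ x, Antitone fun t => quadForm (riccatiSeq A C Q R θ S t) x := fun x =>
    antitone_nat_of_succ_le fun t => by
      rw [riccatiSeq_succ']
      exact riccatiSeq_mono hQ hR hS hV hle hrS hS hle (fun _ => le_rfl) t x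
  have hmono : ∀ x, Monotone fun t => quadForm (riccatiSeq A C Q R θ Q t) x := fun x =>
    monotone_nat_of_le_succ fun t => by
      rw [riccatiSeq_succ']
      exact riccatiSeq_mono hQ hR hS hV hle hQ hrQ (le_riccati hQV)
        (fun y => (riccati_mono hR hQ hS hV hQS y).trans (hle y)) t x
  obtain ⟨P, hPt, hP⟩ := exists_tendsto_of_quadForm (fun t => (memS t).1.transpose_eq)
    fun x => ⟨_, tendsto_atTop_ciInf (hanti x)
      ⟨0, by rintro _ ⟨t, rfl⟩; exact (memS t).1.quadForm_nonneg x⟩⟩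
  obtain ⟨P', hPt', hP'⟩ := exists_tendsto_of_quadForm (fun t => (memQ t).1.transpose_eq)
    fun x => ⟨_, tendsto_atTop_ciSup (hmono x)
      ⟨quadForm S x, by rintro _ ⟨t, rfl⟩; exact (memQ t).2 x⟩⟩
  have hfix := riccati_eq_of_tendsto hQ hR hS hV hle hS (fun _ => le_rfl) hPt hP
  have hfix' := riccati_eq_of_tendsto hQ hR hS hV hle hQ hQS hPt' hP'
  obtain rfl : P = P' := huniq _ _ hfix.1 hfix'.1 hfix.2.1 hfix'.2.1 hfix.2.2 hfix'.2.2
  refine ⟨P, hfix, fun P₀ hP₀ hP₀S => ?_⟩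
  have mem₀ := riccatiSeq_mem hQ hR hS hV hle hP₀ hP₀S
  have hV₀ := posDef_invV_of_le hR hP₀ hS hV hP₀S
  -- `P₀` need not dominate `Q`, but its first iterate does.
  rw [← tendsto_add_atTop_iff_nat 1]
  refine tendsto_of_tendsto_quadForm (fun t => (mem₀ (t + 1)).1.transpose_eq) hPt fun x => ?_
  refine tendsto_of_tendsto_of_tendsto_of_le_of_le (tendsto_quadForm hP' x)
    (tendsto_quadForm ((tendsto_add_atTop_iff_nat 1).2 hP) x) (fun t => ?_) fun t => ?_
  · simp only
    rw [riccatiSeq_succ']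
    exact riccatiSeq_mono hQ hR hS hV hle hQ (riccati_posDef hQ hV₀) (le_riccati hV₀)
      (fun y => (riccati_mono hR hP₀ hS hV hP₀S y).trans (hle y)) t x
  · exact riccatiSeq_mono hQ hR hS hV hle hP₀ hS hP₀S (fun _ => le_rfl) (t + 1) x

/-! ### The Lyapunov bound -/

variable {G : Matrix (Fin n) (Fin m) ℝ} {ρ α : ℝ} {S : Matrix (Fin n) (Fin n) ℝ}

lemma posDef_of_lyapunovEq (hQ : Q.PosDef) (hR : R.PosDef)
    (hM : Tendsto (fun j => (ρ • (A - α • (G * C))) ^ j) atTop (𝓝 0))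
    (hS : LyapunovEq A C Q R G ρ α S) : S.PosDef :=
  posDef_of_lyapunov hM (posDef_mul_mul_transpose_add hR hQ G) (lyapunovEq_iff.1 hS)

lemma posDef_betaMatrix (hR : R.PosDef) (hρ : 1 < ρ) (hα0 : 0 < α) (hα1 : α ≤ 1)
    (hS : S.PosDef) :
    (((ρ ^ 2 - 1) / ρ ^ 2) • S⁻¹ + (1 - α ^ 2) • (Cᵀ * R⁻¹ * C)).PosDef := by
  have h1 : 0 < (ρ ^ 2 - 1) / ρ ^ 2 := div_pos (by nlinarith) (by positivity)
  refine posDef_of_le (hS.inv.smul h1) ?_ fun x => ?_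
  · simp [transpose_inv_eq hS.transpose_eq, transpose_inv_eq hR.transpose_eq, Matrix.mul_assoc]
  · rw [quadForm_add, quadForm_smul (1 - α ^ 2), quadForm_transpose_conj]
    nlinarith [mul_nonneg (by nlinarith : 0 ≤ 1 - α ^ 2) (hR.inv.quadForm_nonneg (C *ᵥ x))]

lemma beta_pos (hn : 0 < n) (hR : R.PosDef) (hρ : 1 < ρ) (hα0 : 0 < α) (hα1 : α ≤ 1)
    (hS : S.PosDef) : 0 < beta C R ρ α S :=
  have : Nonempty (Fin n) := ⟨⟨0, hn⟩⟩
  sigmaMin_pos (posDef_betaMatrix hR hρ hα0 hα1 hS)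

/-- The matrix in `beta` is what `S⁻¹ + Cᵀ R⁻¹ C` exceeds the left-hand side by, and `θ I` lies
below it. -/
lemma le_quadForm_invV_of_le_beta (hR : R.PosDef) (hρ : 1 < ρ) (hα0 : 0 < α) (hα1 : α ≤ 1)
    (hS : S.PosDef) (hθ : θ ≤ beta C R ρ α S) (x : Fin n → ℝ) :
    (ρ ^ 2)⁻¹ * quadForm S⁻¹ x + α ^ 2 * quadForm R⁻¹ (C *ᵥ x) ≤ quadForm (invV C R θ S) x := by
  have h1 := sigmaMin_mul_le (posDef_betaMatrix (C := C) hR hρ hα0 hα1 hS).isHermitian x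
  rw [quadForm_add, quadForm_smul, quadForm_smul, quadForm_transpose_conj] at h1
  have h2 := mul_le_mul_of_nonneg_right hθ (dotProduct_self_nonneg x)
  have h3 : (ρ ^ 2 - 1) / ρ ^ 2 = 1 - (ρ ^ 2)⁻¹ := by field_simp
  rw [h3] at h1
  rw [quadForm_invV]
  unfold beta at h2
  rw [h3] at h2
  linarith

lemma posDef_invV_of_le_beta (hR : R.PosDef) (hρ : 1 < ρ) (hα0 : 0 < α) (hα1 : α ≤ 1)
    (hS : S.PosDef) (hθ : θ ≤ beta C R ρ α S) : (invV C R θ S).PosDef := by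
  refine posDef_of_le (hS.inv.smul (by positivity : 0 < (ρ ^ 2)⁻¹))
    (transpose_invV hR hS.transpose_eq) fun x => ?_
  have := le_quadForm_invV_of_le_beta hR hρ hα0 hα1 hS hθ x
  rw [quadForm_smul]
  nlinarith [mul_nonneg (sq_nonneg α) (hR.inv.quadForm_nonneg (C *ᵥ x))]

/-- The solution of the Lyapunov equation is a supersolution of the Riccati equation. -/
lemma riccati_le_of_le_beta (hR : R.PosDef) (hρ : 1 < ρ) (hα0 : 0 < α) (hα1 : α ≤ 1)
    (hS : S.PosDef) (hSeq : LyapunovEq A C Q R G ρ α S) (hθ : θ ≤ beta C R ρ α S)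
    (x : Fin n → ℝ) : quadForm (riccati A C Q R θ S) x ≤ quadForm S x := by
  have hV := posDef_invV_of_le_beta hR hρ hα0 hα1 hS hθ
  set a := Aᵀ *ᵥ x with ha
  set g := Gᵀ *ᵥ x with hg
  -- The maximizer for the dual form at `a`. The pairing `y·a` splits into `y·(a - α Cᵀ g)` and `α
  -- (C y)·g`; Young's inequality with weights `ρ² S` and `R` bounds them separately.
  set y := (invV C R θ S)⁻¹ *ᵥ a with hy
  have hb : (A - α • (G * C))ᵀ *ᵥ x = a - α • (Cᵀ *ᵥ g) := by
    rw [transpose_sub, transpose_smul, transpose_mul, sub_mulVec, smul_mulVec, mulVec_mulVec]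
  have hSx : quadForm S x = ρ ^ 2 * quadForm S (a - α • (Cᵀ *ᵥ g)) + quadForm R g
      + quadForm Q x := by
    conv_lhs => rw [hSeq]
    rw [quadForm_add, quadForm_add, quadForm_smul, quadForm_conj, quadForm_conj, hb]
  have h1 := quadForm_inv_eq hV a
  rw [← hy] at h1
  have h2 := le_quadForm_invV_of_le_beta hR hρ hα0 hα1 hS hθ y
  have hρS : (ρ ^ 2 • S).PosDef := hS.smul (by positivity)
  have h3 := two_mul_dotProduct_le hρS y (a - α • (Cᵀ *ᵥ g))
  have hinv : (ρ ^ 2 • S)⁻¹ = (ρ ^ 2)⁻¹ • S⁻¹ := by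
    refine inv_eq_left_inv ?_
    rw [Matrix.smul_mul, Matrix.mul_smul, smul_smul, nonsing_inv_mul _ hS.isUnit_det,
      inv_mul_cancel₀ (by positivity), one_smul]
  rw [hinv, quadForm_smul, quadForm_smul, dotProduct_sub, dotProduct_smul,
    dotProduct_mulVec_transpose C, smul_eq_mul] at h3
  have h4 := two_mul_dotProduct_le hR (α • (C *ᵥ y)) g
  rw [quadForm_smul_vec, smul_dotProduct, smul_eq_mul] at h4
  have h5 : a ⬝ᵥ y = y ⬝ᵥ a := dotProduct_comm _ _
  rw [quadForm_riccati, ← ha, hSx]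
  linarith

end Monotone

end URSF

namespace URSF

/-! ### Nonnegativity of the finite horizon cost -/

section CompleteSquare

variable {ι κ μ ν : Type*} [Fintype ι] [Fintype κ] [Fintype μ] [Fintype ν]
  [DecidableEq κ] [DecidableEq μ]

lemma posDef_add_mul_transpose {W : Matrix ν ν ℝ} (hW : W.PosDef) (H : Matrix ν μ ℝ) :
    (W + H * Hᵀ).PosDef := by
  have := posDef_mul_mul_transpose_add (PosDef.one (n := μ) (R := ℝ)) hW H
  rwa [Matrix.mul_one, add_comm] at this

variable [DecidableEq ν]

lemma posDef_one_add {W : Matrix ν ν ℝ} (hW : W.PosDef) (H : Matrix ν μ ℝ) :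
    (1 + Hᵀ * W⁻¹ * H).PosDef := by
  have := posDef_mul_mul_transpose_add hW.inv (PosDef.one (n := μ) (R := ℝ)) Hᵀ
  rwa [transpose_transpose, add_comm] at this

/-- Minimization over the noise of the observation part of the cost. -/
lemma dotProduct_add_quadForm_eq {W : Matrix ν ν ℝ} (hW : W.PosDef) (H : Matrix ν μ ℝ)
    (o : ν → ℝ) (v : μ → ℝ) :
    (v - Hᵀ *ᵥ (W + H * Hᵀ)⁻¹ *ᵥ o) ⬝ᵥ (v - Hᵀ *ᵥ (W + H * Hᵀ)⁻¹ *ᵥ o) +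
        quadForm W⁻¹ (o + H *ᵥ (v - Hᵀ *ᵥ (W + H * Hᵀ)⁻¹ *ᵥ o)) =
      quadForm (1 + Hᵀ * W⁻¹ * H) v + quadForm (W + H * Hᵀ)⁻¹ o := by
  have hE := posDef_add_mul_transpose hW H
  -- The energy is least at the noise `-Hᵀ K`; `v` is the deviation from it, and the cross terms
  -- cancel.
  set K := (W + H * Hᵀ)⁻¹ *ᵥ o with hK
  have ho : o = W *ᵥ K + H *ᵥ Hᵀ *ᵥ K := by
    rw [mulVec_mulVec _ H, ← add_mulVec, hK, mulVec_inv_mulVec hE.isUnit_det]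
  have h1 : o + H *ᵥ (v - Hᵀ *ᵥ K) = W *ᵥ K + H *ᵥ v := by
    rw [mulVec_sub]
    conv_lhs => rw [ho]
    abel
  have h2 := quadForm_mulVec_self hW.isUnit_det K
  have h3 : (W *ᵥ K) ⬝ᵥ W⁻¹ *ᵥ H *ᵥ v = K ⬝ᵥ H *ᵥ v := by
    rw [dotProduct_mulVec_comm (transpose_inv_eq hW.transpose_eq),
      inv_mulVec_mulVec hW.isUnit_det, dotProduct_comm]
  have h4 : quadForm (W + H * Hᵀ)⁻¹ o = quadForm W K + (Hᵀ *ᵥ K) ⬝ᵥ (Hᵀ *ᵥ K) := by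
    rw [quadForm, ← hK]
    conv_lhs => rw [ho]
    rw [add_dotProduct, dotProduct_comm, quadForm, dotProduct_comm _ K]
    congr 1
    have := dotProduct_mulVec_transpose Hᵀ K (Hᵀ *ᵥ K)
    rwa [transpose_transpose] at this
  have h5 : v ⬝ᵥ Hᵀ *ᵥ K = K ⬝ᵥ H *ᵥ v := by
    rw [dotProduct_mulVec_transpose, dotProduct_comm]
  rw [h1, quadForm_add_vec (transpose_inv_eq hW.transpose_eq), h2, h3, h4, quadForm_add,
    quadForm_one, quadForm_transpose_conj, sub_dotProduct, dotProduct_sub, dotProduct_sub, h5,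
    dotProduct_comm (Hᵀ *ᵥ K) v, h5]
  ring

/-- Minimization over the noise of the full cost. -/
lemma quadForm_inv_le_sub {N : Matrix μ μ ℝ} (hN : N.PosDef) (L : Matrix κ μ ℝ) {φ : ℝ}
    (hφ : 0 < φ) (hM : ∀ p, φ * quadForm (L * N⁻¹ * Lᵀ) p ≤ p ⬝ᵥ p)
    (hS : IsUnit (L * N⁻¹ * Lᵀ - φ⁻¹ • (1 : Matrix κ κ ℝ)).det) (j : κ → ℝ) (v : μ → ℝ) :
    quadForm (L * N⁻¹ * Lᵀ - φ⁻¹ • (1 : Matrix κ κ ℝ))⁻¹ j ≤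
      quadForm N v - φ * ((j + L *ᵥ v) ⬝ᵥ (j + L *ᵥ v)) := by
  set M := L * N⁻¹ * Lᵀ with hMdef
  set T := M - φ⁻¹ • (1 : Matrix κ κ ℝ) with hT
  -- Stationarity in `v` reads `v = N⁻¹ Lᵀ u` with `u = φ (j + L v)`, which amounts to `T u = -j`.
  -- Below, `d` is the deviation from this critical point.
  set u := -(T⁻¹ *ᵥ j) with hu
  set d := v - N⁻¹ *ᵥ Lᵀ *ᵥ u with hd
  have hTu : M *ᵥ u - φ⁻¹ • u = -j := by
    have : T *ᵥ u = -j := by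
      rw [hu, mulVec_neg, mulVec_inv_mulVec hS]
    rwa [hT, sub_mulVec, smul_mulVec, one_mulVec] at this
  have hMu : L *ᵥ N⁻¹ *ᵥ Lᵀ *ᵥ u = M *ᵥ u := by simp [hMdef, Matrix.mul_assoc]
  have hv : v = d + N⁻¹ *ᵥ Lᵀ *ᵥ u := by simp [hd]
  have hz : j + L *ᵥ v = L *ᵥ d + φ⁻¹ • u := by
    rw [hv, mulVec_add, hMu]
    have : j = φ⁻¹ • u - M *ᵥ u := by rw [← neg_sub, hTu, neg_neg]
    rw [this]; abel
  have h1 : quadForm N (N⁻¹ *ᵥ Lᵀ *ᵥ u) = quadForm M u := by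
    rw [hMdef, quadForm_conj, quadForm_inv_mulVec hN.isUnit_det]
  have h2 : d ⬝ᵥ N *ᵥ N⁻¹ *ᵥ Lᵀ *ᵥ u = (L *ᵥ d) ⬝ᵥ u := by
    rw [mulVec_inv_mulVec hN.isUnit_det, dotProduct_mulVec_transpose]
  have h3 : quadForm T⁻¹ j = quadForm M u - φ⁻¹ * (u ⬝ᵥ u) := by
    have : quadForm T⁻¹ j = u ⬝ᵥ (M *ᵥ u - φ⁻¹ • u) := by
      rw [hTu, dotProduct_neg, ← neg_dotProduct, hu, neg_neg, dotProduct_comm, quadForm]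
    rw [this, dotProduct_sub, dotProduct_smul, smul_eq_mul, quadForm]
  -- The second variation is nonnegative: the dual form of `φ L N⁻¹ Lᵀ ≤ I`.
  have h4 : φ * ((L *ᵥ d) ⬝ᵥ (L *ᵥ d)) ≤ quadForm N d := by
    have e1 := two_mul_dotProduct_le hN (φ • (Lᵀ *ᵥ L *ᵥ d)) d
    rw [quadForm_smul_vec, ← quadForm_conj, smul_dotProduct, smul_eq_mul, dotProduct_comm _ d,
      dotProduct_mulVec_transpose] at e1
    have e2 := mul_le_mul_of_nonneg_left (hM (L *ᵥ d)) hφ.le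
    linarith
  rw [hz, h3]
  conv_rhs => rw [hv]
  rw [quadForm_add_vec hN.transpose_eq, h1, h2]
  simp only [add_dotProduct, dotProduct_add, smul_dotProduct, dotProduct_smul, smul_eq_mul]
  rw [dotProduct_comm u (L *ᵥ d)]
  have h5 : φ * φ⁻¹ = 1 := mul_inv_cancel₀ hφ.ne'
  have h6 : φ * ((L *ᵥ d) ⬝ᵥ (L *ᵥ d) + φ⁻¹ * ((L *ᵥ d) ⬝ᵥ u) +
      (φ⁻¹ * ((L *ᵥ d) ⬝ᵥ u) + φ⁻¹ * (φ⁻¹ * (u ⬝ᵥ u)))) =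
      φ * ((L *ᵥ d) ⬝ᵥ (L *ᵥ d)) + 2 * ((L *ᵥ d) ⬝ᵥ u) + φ⁻¹ * (u ⬝ᵥ u) := by
    field_simp
    ring
  linarith

end CompleteSquare

/-! ### The Gramian as a lower bound of the cost, and positivity of `phiK` -/

section Cost

variable {n m : ℕ} (A : Matrix (Fin n) (Fin n) ℝ) (C : Matrix (Fin m) (Fin n) ℝ)
  (R : Matrix (Fin m) (Fin m) ℝ) (B : Matrix (Fin n) (Fin n) ℝ) (k : ℕ)

/-- The energy of the process and observation noises along a trajectory of length `k` with zero
observations, as a function of the initial state and the process noise. -/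
noncomputable def noiseEnergy (x : Fin n → ℝ) (w : Fin k × Fin n → ℝ) : ℝ :=
  w ⬝ᵥ w + quadForm (noiseCov R k)⁻¹ (obsO A C k *ᵥ x + toepH A C B k *ᵥ w)

/-- The states of a trajectory of length `k`, in reverse order. -/
def trajectory (x : Fin n → ℝ) (w : Fin k × Fin n → ℝ) : Fin k × Fin n → ℝ :=
  obsOR A k *ᵥ x + toepL A B k *ᵥ w

variable {A C R B k}

lemma noiseCov_posDef (hR : R.PosDef) : (noiseCov R k).PosDef := PosDef.one.kronecker hR

lemma transpose_errCov (hR : R.PosDef) : (errCov A C R B k)ᵀ = errCov A C R B k := by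
  have hN := posDef_one_add (noiseCov_posDef (k := k) hR) (toepH A C B k)
  rw [errCov, transpose_mul, transpose_mul, transpose_transpose,
    transpose_inv_eq hN.transpose_eq, ← Matrix.mul_assoc]

lemma quadForm_errCov_le (hR : R.PosDef) (p : Fin k × Fin n → ℝ) :
    quadForm (errCov A C R B k) p ≤ sigmaMax (errCov A C R B k) * (p ⬝ᵥ p) :=
  le_sigmaMax_mul (by
    rw [IsHermitian, conjTranspose_eq_transpose_of_trivial, transpose_errCov hR]) p

lemma posDef_neg_matS (hR : R.PosDef) {φ : ℝ} (hφ : 0 < φ)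
    (hσ : φ * sigmaMax (errCov A C R B k) < 1) : (-matS A C R B k φ).PosDef := by
  rw [posDef_iff]
  refine ⟨by simp [matS, transpose_errCov hR], fun x hx => ?_⟩
  rw [matS, neg_sub, quadForm_sub, quadForm_smul, quadForm_one]
  have h1 := quadForm_errCov_le (A := A) (C := C) (B := B) hR x
  have h2 : sigmaMax (errCov A C R B k) < φ⁻¹ := by
    rwa [← one_div, lt_div_iff₀' hφ]
  nlinarith [dotProduct_self_pos hx]

lemma quadForm_gramian (φ : ℝ) (x : Fin n → ℝ) : quadForm (gramian A C R B k φ) x =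
    quadForm (noiseCov R k + toepH A C B k * (toepH A C B k)ᵀ)⁻¹ (obsO A C k *ᵥ x) +
      quadForm (matS A C R B k φ)⁻¹ (matJ A C R B k *ᵥ x) := by
  rw [gramian, quadForm_add, quadForm_transpose_conj, quadForm_transpose_conj]

/-- The noise `-u` minimizes the noise energy and `matJ` gives the resulting trajectory; the
deviation `w + u` is then handled by the second completion of squares. -/
lemma quadForm_gramian_le (hR : R.PosDef) {φ : ℝ} (hφ : 0 < φ)
    (hσ : φ * sigmaMax (errCov A C R B k) < 1) (x : Fin n → ℝ) (w : Fin k × Fin n → ℝ) :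
    quadForm (gramian A C R B k φ) x ≤ noiseEnergy A C R B k x w -
      φ * (trajectory A B k x w ⬝ᵥ trajectory A B k x w) := by
  have hW := noiseCov_posDef (k := k) hR
  have hN := posDef_one_add hW (toepH A C B k)
  have hS : IsUnit (matS A C R B k φ).det := by
    have := (posDef_neg_matS hR hφ hσ).isUnit
    exact (isUnit_iff_isUnit_det _).1 (IsUnit.neg_iff _ |>.1 this)
  have hM : ∀ p, φ * quadForm (errCov A C R B k) p ≤ p ⬝ᵥ p := fun p => by
    nlinarith [quadForm_errCov_le (A := A) (C := C) (B := B) hR p, dotProduct_self_nonneg p]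
  set u := (toepH A C B k)ᵀ *ᵥ (noiseCov R k + toepH A C B k * (toepH A C B k)ᵀ)⁻¹ *ᵥ
    obsO A C k *ᵥ x with hu
  have h1 := dotProduct_add_quadForm_eq hW (toepH A C B k) (obsO A C k *ᵥ x) (w + u)
  rw [← hu, add_sub_cancel_right] at h1
  have h2 := quadForm_inv_le_sub hN (toepL A B k) hφ hM hS (matJ A C R B k *ᵥ x) (w + u)
  have h3 : matJ A C R B k *ᵥ x + toepL A B k *ᵥ (w + u) = trajectory A B k x w := by
    rw [matJ, sub_mulVec, trajectory, mulVec_add, hu]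
    simp only [← mulVec_mulVec]
    abel
  rw [h3] at h2
  rw [quadForm_gramian, noiseEnergy, h1]
  have h4 : quadForm (matS A C R B k φ)⁻¹ (matJ A C R B k *ᵥ x) ≤ _ := h2
  linarith

/-- For `θ ≤ φ_k` the energy of the noises dominates `θ` times the energy of the states. -/
lemma le_noiseEnergy_of_le_phiK (hR : R.PosDef) {θ : ℝ} (hθ0 : 0 < θ)
    (hθ : θ ≤ phiK A C R B k) (x : Fin n → ℝ) (w : Fin k × Fin n → ℝ) :
    θ * (trajectory A B k x w ⬝ᵥ trajectory A B k x w) ≤ noiseEnergy A C R B k x w := by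
  by_contra! hlt
  set b := trajectory A B k x w ⬝ᵥ trajectory A B k x w with hb
  set a := noiseEnergy A C R B k x w with ha
  have hb0 : 0 ≤ b := dotProduct_self_nonneg _
  have ha0 : 0 ≤ a := add_nonneg (dotProduct_self_nonneg _)
    ((noiseCov_posDef hR).inv.quadForm_nonneg _)
  have hbpos : 0 < b := by
    rcases hb0.lt_or_eq with h | h
    · exact h
    · rw [← h, mul_zero] at hlt
      exact absurd hlt ha0.not_gt
  -- The supremum need not be attained, but the strict inequality leaves room for an admissible `φ`
  -- above `a / b`.
  have hab : a / b < phiK A C R B k := ((div_lt_iff₀ hbpos).2 hlt).trans_le hθ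
  have hne : {φ : ℝ | 0 < φ ∧ φ * sigmaMax (errCov A C R B k) < 1 ∧
      (gramian A C R B k φ).PosDef}.Nonempty := by
    by_contra h
    rw [Set.not_nonempty_iff_eq_empty] at h
    rw [phiK, h, Real.sSup_empty] at hθ
    linarith
  obtain ⟨φ, ⟨hφ, hσ, hG⟩, hφab⟩ := exists_lt_of_lt_csSup hne hab
  have h1 := quadForm_gramian_le hR hφ hσ x w
  have h2 := (div_lt_iff₀ hbpos).1 hφab
  linarith [hG.quadForm_nonneg x]

lemma trajectory_ne_zero (hk : 0 < k) {x : Fin n → ℝ} (hx : x ≠ 0) :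
    trajectory A B k x 0 ≠ 0 := by
  intro h
  apply hx
  ext a
  have := congrFun h (⟨k - 1, by omega⟩, a)
  simpa [trajectory, obsOR, mulVec, dotProduct, one_apply] using this

lemma mulVec_obsO_ne_zero (hk : n ≤ k) (hobs : IsObservable A C) {x : Fin n → ℝ} (hx : x ≠ 0) :
    obsO A C k *ᵥ x ≠ 0 := by
  intro h
  apply hx
  set M := Matrix.of fun (p : Fin n × Fin m) (j : Fin n) => (C * A ^ (p.1 : ℕ)) p.2 j with hM
  have hker : LinearMap.ker M.mulVecLin = ⊥ := by
    have h1 := LinearMap.finrank_range_add_finrank_ker M.mulVecLin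
    have h2 : Module.finrank ℝ (LinearMap.range M.mulVecLin) = n := hobs
    rw [h2, Module.finrank_fin_fun] at h1
    exact Submodule.finrank_eq_zero.1 (by omega)
  have hx0 : x ∈ LinearMap.ker M.mulVecLin := by
    rw [LinearMap.mem_ker, mulVecLin_apply]
    ext p
    -- The block rows of `obsO` are in reverse order, and `n ≤ k` makes all powers below `n` occur.
    have := congrFun h (⟨k - 1 - p.1, by omega⟩, p.2)
    have e : k - 1 - (k - 1 - (p.1 : ℕ)) = p.1 := by omega
    simpa [obsO, mulVec, dotProduct, hM, e] using this
  rwa [hker, Submodule.mem_bot] at hx0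

/-- Observability bounds the first Gramian term below by some `c > 0`, while the second is at least
`-2 φ d`; a small `φ` suffices. -/
lemma phiK_pos (hn : 0 < n) (hk : n ≤ k) (hR : R.PosDef) (hobs : IsObservable A C) :
    0 < phiK A C R B k := by
  have : Nonempty (Fin n) := ⟨⟨0, hn⟩⟩
  have hE := posDef_add_mul_transpose (noiseCov_posDef (k := k) hR) (toepH A C B k)
  -- The real supremum of an unbounded set is `0` by convention. The zero noise and a nonzero
  -- initial state give a bound.
  have hbdd : BddAbove {φ : ℝ | 0 < φ ∧ φ * sigmaMax (errCov A C R B k) < 1 ∧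
      (gramian A C R B k φ).PosDef} := by
    obtain ⟨x, hx⟩ := exists_ne (0 : Fin n → ℝ)
    have hb := dotProduct_self_pos (trajectory_ne_zero (A := A) (B := B) (hn.trans_le hk) hx)
    refine ⟨noiseEnergy A C R B k x 0 / (trajectory A B k x 0 ⬝ᵥ trajectory A B k x 0), ?_⟩
    rintro φ ⟨hφ, hσ, hG⟩
    rw [le_div_iff₀ hb]
    linarith [quadForm_gramian_le hR hφ hσ x 0, hG.quadForm_nonneg x]
  have hG0 : ((obsO A C k)ᵀ * (noiseCov R k + toepH A C B k * (toepH A C B k)ᵀ)⁻¹ *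
      obsO A C k).PosDef := by
    rw [posDef_iff]
    constructor
    · simp [transpose_mul, transpose_inv_eq hE.transpose_eq, Matrix.mul_assoc]
    · intro x hx
      rw [quadForm_transpose_conj]
      exact hE.inv.quadForm_pos (mulVec_obsO_ne_zero hk hobs hx)
  obtain ⟨c, hc, hcG⟩ := exists_pos_mul_le hG0
  obtain ⟨d, hd, hdJ⟩ := exists_le_mul (M := (matJ A C R B k)ᵀ * (1 : Matrix (Fin k × Fin n) (Fin k × Fin n) ℝ) *
    matJ A C R B k)
    (by simp)
  set σ := sigmaMax (errCov A C R B k) with hσdef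
  -- The first bound yields `φ σ ≤ 1 / 2`, so that the inverse of `-matS` is at most `2 φ`; the
  -- second yields `2 φ d ≤ c / 2`.
  set φ := min (1 / (2 * (|σ| + 1))) (c / (4 * d)) with hφdef
  have hφ : 0 < φ := lt_min (by positivity) (by positivity)
  have hφσ : φ * σ ≤ 1 / 2 := by
    have h1 : φ * (|σ| + 1) ≤ 1 / 2 := by
      have := (le_div_iff₀ (by positivity)).1 (min_le_left (1 / (2 * (|σ| + 1))) (c / (4 * d)))
      rw [← hφdef] at this
      linarith
    nlinarith [le_abs_self σ]
  have hφd : 4 * (φ * d) ≤ c := by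
    have := (le_div_iff₀ (by positivity)).1 (min_le_right (1 / (2 * (|σ| + 1))) (c / (4 * d)))
    rw [← hφdef] at this
    linarith
  have hT := posDef_neg_matS (A := A) (C := C) (B := B) (k := k) hR hφ (by linarith)
  have hTinv : ∀ y, quadForm (-matS A C R B k φ)⁻¹ y ≤ 2 * φ * (y ⬝ᵥ y) := by
    intro y
    have h0 : (0 : ℝ) < (2 * φ)⁻¹ := by positivity
    have hpd : ((2 * φ)⁻¹ • (1 : Matrix (Fin k × Fin n) (Fin k × Fin n) ℝ)).PosDef :=
      PosDef.one.smul h0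
    have h1 := quadForm_inv_le hpd hT (fun x => ?_) y
    · have h2 : ((2 * φ)⁻¹ • (1 : Matrix (Fin k × Fin n) (Fin k × Fin n) ℝ))⁻¹ =
          (2 * φ) • 1 := by
        refine inv_eq_left_inv ?_
        rw [smul_mul_smul_comm, mul_inv_cancel₀ (by positivity), Matrix.one_mul, one_smul]
      rwa [h2, quadForm_smul, quadForm_one] at h1
    · rw [matS, neg_sub, quadForm_sub, quadForm_smul, quadForm_smul, quadForm_one]
      have h2 := quadForm_errCov_le (A := A) (C := C) (B := B) hR x
      have h3 : σ ≤ (2 * φ)⁻¹ := by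
        rw [← one_div, le_div_iff₀' (by positivity : 0 < 2 * φ)]
        linarith
      have h4 : φ⁻¹ = (2 * φ)⁻¹ + (2 * φ)⁻¹ := by field_simp; norm_num
      rw [h4]
      have h5 := mul_le_mul_of_nonneg_right h3 (dotProduct_self_nonneg x)
      linarith
  refine hφ.trans_le (le_csSup hbdd ⟨hφ, by linarith, ?_⟩)
  refine posDef_of_le (hG0.smul (one_half_pos (α := ℝ))) ?_ fun x => ?_
  · have hS : (matS A C R B k φ)ᵀ = matS A C R B k φ := by simp [matS, transpose_errCov hR]
    simp [gramian, transpose_inv_eq hE.transpose_eq, transpose_inv_eq hS, Matrix.mul_assoc]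
  · have h1 := hTinv (matJ A C R B k *ᵥ x)
    have h2 : (-matS A C R B k φ)⁻¹ = -(matS A C R B k φ)⁻¹ := by
      refine inv_eq_left_inv ?_
      have : IsUnit (matS A C R B k φ).det :=
        (isUnit_iff_isUnit_det _).1 ((IsUnit.neg_iff _).1 hT.isUnit)
      rw [Matrix.neg_mul, Matrix.mul_neg, neg_neg, nonsing_inv_mul _ this]
    have h3 := hdJ x
    rw [quadForm_transpose_conj, quadForm_one] at h3
    have h4 : quadForm (-(matS A C R B k φ)⁻¹) (matJ A C R B k *ᵥ x) =
        -quadForm (matS A C R B k φ)⁻¹ (matJ A C R B k *ᵥ x) := by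
      simp [quadForm, neg_mulVec]
    rw [h2, h4] at h1
    have h5 := hcG x
    rw [quadForm_smul, quadForm_gramian]
    rw [quadForm_transpose_conj] at h5 ⊢
    have h6 := mul_le_mul_of_nonneg_left h3 (by positivity : (0 : ℝ) ≤ 2 * φ)
    have h7 := mul_le_mul_of_nonneg_right hφd (dotProduct_self_nonneg x)
    linarith

/-! ### The cost along a trajectory -/

lemma blockH_eq (t : ℕ) : blockH A C B t = C * blockL A B t := by
  cases t <;> simp [blockH, blockL, Matrix.mul_assoc]

lemma toepL_mulVec (w : Fin k × Fin n → ℝ) (i : Fin k) (a : Fin n) :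
    (toepL A B k *ᵥ w) (i, a) =
      (∑ j : Fin k, if i ≤ j then blockL A B (j - i) *ᵥ (fun b => w (j, b)) else 0) a := by
  rw [mulVec, dotProduct, Fintype.sum_prod_type, Finset.sum_apply]
  refine Finset.sum_congr rfl fun j _ => ?_
  simp only [toepL, blockToeplitz, of_apply]
  split_ifs <;> simp [mulVec, dotProduct, *]

lemma toepH_mulVec (w : Fin k × Fin n → ℝ) (i : Fin k) (a : Fin m) :
    (toepH A C B k *ᵥ w) (i, a) = (C *ᵥ fun b => (toepL A B k *ᵥ w) (i, b)) a := by
  have h1 : (fun b => (toepL A B k *ᵥ w) (i, b)) =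
      ∑ j : Fin k, if i ≤ j then blockL A B (j - i) *ᵥ (fun b => w (j, b)) else 0 :=
    funext fun b => toepL_mulVec w i b
  rw [h1, mulVec_sum, mulVec, dotProduct, Fintype.sum_prod_type, Finset.sum_apply]
  refine Finset.sum_congr rfl fun j _ => ?_
  simp only [toepH, blockToeplitz, of_apply]
  split_ifs with h
  · rw [mulVec_mulVec, ← blockH_eq]
    simp [mulVec, dotProduct]
  · simp

lemma observation_eq (x : Fin n → ℝ) (w : Fin k × Fin n → ℝ) (i : Fin k) (a : Fin m) :
    (obsO A C k *ᵥ x + toepH A C B k *ᵥ w) (i, a) =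
      (C *ᵥ fun b => trajectory A B k x w (i, b)) a := by
  have h1 : (fun b => trajectory A B k x w (i, b)) =
      A ^ (k - 1 - (i : ℕ)) *ᵥ x + fun b => (toepL A B k *ᵥ w) (i, b) := by
    ext b
    simp [trajectory, obsOR, mulVec, dotProduct]
  rw [h1, mulVec_add, Pi.add_apply, Pi.add_apply, toepH_mulVec, mulVec_mulVec]
  simp [obsO, mulVec, dotProduct]

lemma quadForm_noiseCov_inv (y : Fin k × Fin m → ℝ) :
    quadForm (noiseCov R k)⁻¹ y = ∑ i, quadForm R⁻¹ fun a => y (i, a) := by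
  rw [noiseCov, inv_kronecker, inv_one, quadForm, dotProduct, Fintype.sum_prod_type]
  refine Finset.sum_congr rfl fun i _ => ?_
  rw [quadForm, dotProduct]
  refine Finset.sum_congr rfl fun a _ => ?_
  congr 1
  rw [mulVec, dotProduct, Fintype.sum_prod_type, mulVec, dotProduct,
    Finset.sum_eq_single i]
  · simp
  · intro j _ hj
    simp [one_apply_ne' hj]
  · simp

lemma dotProduct_prod (w v : Fin k × Fin n → ℝ) :
    w ⬝ᵥ v = ∑ i, (fun a => w (i, a)) ⬝ᵥ fun a => v (i, a) := by
  simp only [dotProduct, Fintype.sum_prod_type]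

lemma trajectory_eq {z w : ℕ → Fin n → ℝ} (h : ∀ i, z i = A *ᵥ z (i + 1) + B *ᵥ w (i + 1))
    (i : Fin k) (a : Fin n) :
    trajectory A B k (z (k - 1)) (fun p => w p.1 p.2) (i, a) = z i a := by
  -- The dynamics run towards smaller indices, so the induction moves the starting index `K` away
  -- from `i`. The term `j = i` vanishes because `blockL` is `0` at `0`.
  have key : ∀ K, (i : ℕ) ≤ K → z i = A ^ (K - i) *ᵥ z K +
      ∑ j ∈ Finset.range (K + 1), if (i : ℕ) ≤ j then blockL A B (j - i) *ᵥ w j else 0 := by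
    intro K hK
    induction K, hK using Nat.le_induction with
    | base =>
      rw [Finset.sum_eq_zero]
      · simp
      · intro j hj
        split_ifs with hij
        · have : j = i := by have := Finset.mem_range.1 hj; omega
          simp [this, blockL]
        · rfl
    | succ K hK ih =>
      rw [Finset.sum_range_succ, if_pos (by omega), Nat.succ_sub hK, blockL, ih, h K]
      simp only [mulVec_add, mulVec_mulVec, pow_succ]
      abel
  have hi := i.2
  have h1 := congrFun (key (k - 1) (by omega)) a
  rw [show k - 1 + 1 = k by omega, Finset.sum_range] at h1
  rw [trajectory, Pi.add_apply, toepL_mulVec, h1, Pi.add_apply]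
  rfl

lemma sum_cost_nonneg (hR : R.PosDef) {θ : ℝ} (hθ0 : 0 < θ) (hθ : θ ≤ phiK A C R B k)
    {z w : ℕ → Fin n → ℝ} (h : ∀ i, z i = A *ᵥ z (i + 1) + B *ᵥ w (i + 1)) :
    0 ≤ ∑ i ∈ Finset.range k, (w i ⬝ᵥ w i + quadForm R⁻¹ (C *ᵥ z i) - θ * (z i ⬝ᵥ z i)) := by
  have h1 := le_noiseEnergy_of_le_phiK hR hθ0 hθ (z (k - 1)) (fun p => w p.1 p.2)
  have h2 : ∀ i : Fin k, (fun a => trajectory A B k (z (k - 1)) (fun p => w p.1 p.2) (i, a)) =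
      z i := fun i => funext fun a => trajectory_eq h i a
  rw [noiseEnergy, quadForm_noiseCov_inv, dotProduct_prod, dotProduct_prod] at h1
  simp only [observation_eq, h2] at h1
  rw [Finset.sum_range, Finset.sum_sub_distrib, Finset.sum_add_distrib, ← Finset.mul_sum]
  linarith

end Cost

end URSF

namespace URSF

/-! ### Uniqueness of the solution of the Riccati equation -/

section Uniqueness

variable {n m k : ℕ} {A : Matrix (Fin n) (Fin n) ℝ} {C : Matrix (Fin m) (Fin n) ℝ}
  {Q : Matrix (Fin n) (Fin n) ℝ} {R : Matrix (Fin m) (Fin m) ℝ} {B : Matrix (Fin n) (Fin n) ℝ}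
  {θ : ℝ}

/-- The backward dynamics `(P⁻¹ + Cᵀ R⁻¹ C - θ I)⁻¹ Aᵀ P⁻¹` along which the cost of a trajectory
is stationary. -/
noncomputable def backward (A : Matrix (Fin n) (Fin n) ℝ) (C : Matrix (Fin m) (Fin n) ℝ)
    (R : Matrix (Fin m) (Fin m) ℝ) (θ : ℝ) (P : Matrix (Fin n) (Fin n) ℝ) :
    Matrix (Fin n) (Fin n) ℝ :=
  (invV C R θ P)⁻¹ * Aᵀ * P⁻¹

lemma backward_eq {P : Matrix (Fin n) (Fin n) ℝ} (hB : B * Bᵀ = Q) (hP : P.PosDef)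
    (hfix : riccati A C Q R θ P = P) (x : Fin n → ℝ) :
    x = A *ᵥ backward A C R θ P *ᵥ x + B *ᵥ Bᵀ *ᵥ P⁻¹ *ᵥ x := by
  have h : A *ᵥ backward A C R θ P *ᵥ x + B *ᵥ Bᵀ *ᵥ P⁻¹ *ᵥ x =
      riccati A C Q R θ P *ᵥ P⁻¹ *ᵥ x := by
    rw [riccati, ← hB, add_mulVec]
    simp only [mulVec_mulVec, backward, Matrix.mul_assoc]
  rw [h, hfix, mulVec_inv_mulVec hP.isUnit_det]

/-- The dissipation equality along the backward dynamics. -/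
lemma quadForm_sub_backward {P : Matrix (Fin n) (Fin n) ℝ} (hB : B * Bᵀ = Q)
    (hP : P.PosDef) (hV : IsUnit (invV C R θ P).det) (hfix : riccati A C Q R θ P = P)
    (x : Fin n → ℝ) :
    quadForm P⁻¹ x - quadForm P⁻¹ (backward A C R θ P *ᵥ x) =
      (Bᵀ *ᵥ P⁻¹ *ᵥ x) ⬝ᵥ (Bᵀ *ᵥ P⁻¹ *ᵥ x) +
        quadForm R⁻¹ (C *ᵥ backward A C R θ P *ᵥ x) -
        θ * ((backward A C R θ P *ᵥ x) ⬝ᵥ (backward A C R θ P *ᵥ x)) := by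
  set y := backward A C R θ P *ᵥ x with hy
  have h1 := quadForm_invV (C := C) (R := R) (θ := θ) P y
  have h2 : quadForm (invV C R θ P) y = quadForm (invV C R θ P)⁻¹ (Aᵀ *ᵥ P⁻¹ *ᵥ x) := by
    rw [← quadForm_inv_mulVec hV, hy, backward]
    simp only [mulVec_mulVec, Matrix.mul_assoc]
  have h3 : quadForm P⁻¹ x = quadForm P (P⁻¹ *ᵥ x) :=
    (quadForm_inv_mulVec hP.isUnit_det x).symm
  have h4 : (Bᵀ *ᵥ P⁻¹ *ᵥ x) ⬝ᵥ (Bᵀ *ᵥ P⁻¹ *ᵥ x) = quadForm Q (P⁻¹ *ᵥ x) := by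
    rw [← quadForm_one, ← quadForm_conj, Matrix.mul_one, hB]
  have h5 := quadForm_riccati (A := A) (C := C) (Q := Q) (R := R) (θ := θ) P (P⁻¹ *ᵥ x)
  rw [hfix] at h5
  linarith

/-- The dissipation equality telescopes to the cost of a trajectory plus `Q(P⁻¹ x) > 0`. Only
invertibility of `invV` is needed, so uniqueness covers fixed points where it might be indefinite.
-/
lemma quadForm_backward_pow_lt (hk : 0 < k) (hQ : Q.PosDef) (hR : R.PosDef)
    (hB : B * Bᵀ = Q) (hθ0 : 0 < θ) (hθ : θ ≤ phiK A C R B k) {P : Matrix (Fin n) (Fin n) ℝ}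
    (hP : P.PosDef) (hV : IsUnit (invV C R θ P).det) (hfix : riccati A C Q R θ P = P)
    {x : Fin n → ℝ} (hx : x ≠ 0) :
    quadForm P⁻¹ (backward A C R θ P ^ k *ᵥ x) < quadForm P⁻¹ x := by
  obtain ⟨k, rfl⟩ : ∃ l, k = l + 1 := ⟨k - 1, by omega⟩
  set Φ := backward A C R θ P with hΦ
  let z : ℕ → Fin n → ℝ := fun i => Φ ^ (i + 1) *ᵥ x
  -- The noise `w 0` drives none of the states `z i`, so it may be zero; the discarded term `|Bᵀ P⁻¹
  -- x|²` gives strictness.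
  let w : ℕ → Fin n → ℝ
    | 0 => 0
    | i + 1 => Bᵀ *ᵥ P⁻¹ *ᵥ Φ ^ (i + 1) *ᵥ x
  have hz : ∀ i, z i = A *ᵥ z (i + 1) + B *ᵥ w (i + 1) := fun i => by
    have h := backward_eq hB hP hfix (Φ ^ (i + 1) *ᵥ x)
    rw [← hΦ, mulVec_mulVec _ Φ, ← pow_succ'] at h
    exact h
  have hcost := sum_cost_nonneg (k := k + 1) hR hθ0 hθ hz
  have hdiss : ∀ i, quadForm P⁻¹ (Φ ^ i *ᵥ x) - quadForm P⁻¹ (Φ ^ (i + 1) *ᵥ x) =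
      (Bᵀ *ᵥ P⁻¹ *ᵥ Φ ^ i *ᵥ x) ⬝ᵥ (Bᵀ *ᵥ P⁻¹ *ᵥ Φ ^ i *ᵥ x) +
        quadForm R⁻¹ (C *ᵥ z i) - θ * (z i ⬝ᵥ z i) := fun i => by
    have h := quadForm_sub_backward hB hP hV hfix (Φ ^ i *ᵥ x)
    rwa [← hΦ, mulVec_mulVec _ Φ, ← pow_succ'] at h
  have htel := Finset.sum_range_sub' (fun i => quadForm P⁻¹ (Φ ^ i *ᵥ x)) (k + 1)
  simp only [hdiss] at htel
  rw [Finset.sum_range_succ'] at htel hcost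
  have h0 : 0 < (Bᵀ *ᵥ P⁻¹ *ᵥ Φ ^ 0 *ᵥ x) ⬝ᵥ (Bᵀ *ᵥ P⁻¹ *ᵥ Φ ^ 0 *ᵥ x) := by
    rw [← quadForm_one, ← quadForm_conj, Matrix.mul_one, hB, pow_zero, one_mulVec]
    refine hQ.quadForm_pos fun h => hx ?_
    rw [← mulVec_inv_mulVec hP.isUnit_det x, h, mulVec_zero]
  have hw0 : w 0 ⬝ᵥ w 0 = 0 := by simp [w]
  simp only [hw0] at hcost
  simp only [pow_zero, one_mulVec] at htel h0
  linarith

lemma tendsto_backward_pow (hk : 0 < k) (hQ : Q.PosDef) (hR : R.PosDef)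
    (hB : B * Bᵀ = Q) (hθ0 : 0 < θ) (hθ : θ ≤ phiK A C R B k) {P : Matrix (Fin n) (Fin n) ℝ}
    (hP : P.PosDef) (hV : IsUnit (invV C R θ P).det) (hfix : riccati A C Q R θ P = P) :
    Tendsto (fun j => (backward A C R θ P ^ k) ^ j) atTop (𝓝 0) :=
  tendsto_pow_of_lyapunov hP.inv fun _ hx =>
    quadForm_backward_pow_lt hk hQ hR hB hθ0 hθ hP hV hfix hx

/-- The identity `X⁻¹ - Y⁻¹ = X⁻¹ (Y - X) Y⁻¹` is used for `P`, `P'` and for their `invV`, whose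
difference is again that of the inverses. -/
lemma inv_sub_inv_eq_backward (hR : R.PosDef) {P P' : Matrix (Fin n) (Fin n) ℝ}
    (hP : P.PosDef) (hP' : P'.PosDef) (hV : IsUnit (invV C R θ P).det)
    (hV' : IsUnit (invV C R θ P').det) (hfix : riccati A C Q R θ P = P)
    (hfix' : riccati A C Q R θ P' = P') :
    P'⁻¹ - P⁻¹ = (backward A C R θ P)ᵀ * (P'⁻¹ - P⁻¹) * backward A C R θ P' := by
  have h1 : P - P' = A * ((invV C R θ P)⁻¹ - (invV C R θ P')⁻¹) * Aᵀ := by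
    conv_lhs => rw [← hfix, ← hfix']
    simp only [riccati, Matrix.mul_sub, Matrix.sub_mul]
    abel
  have h2 : ∀ {X Y : Matrix (Fin n) (Fin n) ℝ}, IsUnit X.det → IsUnit Y.det →
      X⁻¹ - Y⁻¹ = X⁻¹ * (Y - X) * Y⁻¹ := fun {X Y} hX hY => by
    rw [Matrix.mul_sub, Matrix.sub_mul, nonsing_inv_mul _ hX, Matrix.one_mul,
      mul_nonsing_inv_cancel_right _ _ hY]
  have h3 : invV C R θ P' - invV C R θ P = P'⁻¹ - P⁻¹ := by
    simp only [invV]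
    abel
  rw [h2 hV hV', h3] at h1
  have h4 : P'⁻¹ - P⁻¹ = P⁻¹ * (P - P') * P'⁻¹ := by
    rw [Matrix.mul_sub, Matrix.sub_mul, nonsing_inv_mul _ hP.isUnit_det, Matrix.one_mul,
      mul_nonsing_inv_cancel_right _ _ hP'.isUnit_det]
  conv_lhs => rw [h4, h1]
  simp only [backward, transpose_mul, transpose_transpose, transpose_inv_eq hP.transpose_eq,
    transpose_inv_eq (transpose_invV hR hP.transpose_eq), Matrix.mul_assoc]

/-- The Riccati equation has at most one positive definite solution. -/
theorem riccati_unique (hk : 0 < k) (hQ : Q.PosDef) (hR : R.PosDef)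
    (hB : B * Bᵀ = Q) (hθ0 : 0 < θ) (hθ : θ ≤ phiK A C R B k)
    {P P' : Matrix (Fin n) (Fin n) ℝ} (hP : P.PosDef) (hP' : P'.PosDef)
    (hV : IsUnit (invV C R θ P).det) (hV' : IsUnit (invV C R θ P').det)
    (hfix : riccati A C Q R θ P = P) (hfix' : riccati A C Q R θ P' = P') : P = P' := by
  have h := inv_sub_inv_eq_backward hR hP hP' hV hV' hfix hfix'
  have hpow : ∀ j : ℕ, P'⁻¹ - P⁻¹ =
      (backward A C R θ P)ᵀ ^ j * (P'⁻¹ - P⁻¹) * backward A C R θ P' ^ j := by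
    intro j
    induction j with
    | zero => simp
    | succ j ih =>
      conv_lhs => rw [ih, h]
      rw [pow_succ, pow_succ' (backward A C R θ P')]
      simp only [Matrix.mul_assoc]
  have hlim := tendsto_transpose_pow (tendsto_backward_pow hk hQ hR hB hθ0 hθ hP hV hfix)
  rw [transpose_pow] at hlim
  have h0 := eq_zero_of_eq_mul_mul hlim
    (tendsto_backward_pow hk hQ hR hB hθ0 hθ hP' hV' hfix') (hpow k)
  rw [← nonsing_inv_nonsing_inv P hP.isUnit_det, ← nonsing_inv_nonsing_inv P' hP'.isUnit_det,
    sub_eq_zero.1 h0]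

/-! ### Stability of the filter -/

/-- The error dynamics of the filter are stable at a solution of the Riccati equation. -/
theorem isStable_gain (hQ : Q.PosDef) (hR : R.PosDef) (hθ0 : 0 < θ)
    {P : Matrix (Fin n) (Fin n) ℝ} (hP : P.PosDef) (hV : (invV C R θ P).PosDef)
    (hfix : riccati A C Q R θ P = P) : IsStable (A * (1 - gain C R P * C)) := by
  have hE := posDef_mul_mul_transpose_add hP hR C
  -- With `b` the image of `x`, Young's inequality at `P b` gives `P(x) ≥ P(b) + R(g) + θ |P b|² +
  -- Q(x)`; the risk term only helps.
  have key : ∀ x, x ≠ 0 → quadForm P ((A * (1 - gain C R P * C))ᵀ *ᵥ x) < quadForm P x := by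
    intro x hx
    set a := Aᵀ *ᵥ x with ha
    set g := (C * P * Cᵀ + R)⁻¹ *ᵥ C *ᵥ P *ᵥ a with hg
    set b := a - Cᵀ *ᵥ g with hb
    have hKx : (A * (1 - gain C R P * C))ᵀ *ᵥ x = b := by
      rw [hb, hg, ha, gain]
      simp only [transpose_mul, transpose_sub, transpose_one, transpose_transpose,
        hP.transpose_eq, transpose_inv_eq hE.transpose_eq, ← mulVec_mulVec, sub_mulVec,
        one_mulVec]
    have hRg : R *ᵥ g = C *ᵥ P *ᵥ b := by
      have h1 : (C * P * Cᵀ + R) *ᵥ g = C *ᵥ P *ᵥ a := by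
        rw [hg, mulVec_inv_mulVec hE.isUnit_det]
      rw [add_mulVec, ← mulVec_mulVec, ← mulVec_mulVec] at h1
      rw [hb, mulVec_sub, mulVec_sub, ← h1]
      abel
    have h1 : a = b + Cᵀ *ᵥ g := by simp [hb]
    have h2 : quadForm R⁻¹ (C *ᵥ P *ᵥ b) = quadForm R g := by
      rw [← hRg, quadForm_mulVec_self hR.isUnit_det]
    have h3 := quadForm_mulVec_self hP.isUnit_det b
    have h4 : a ⬝ᵥ P *ᵥ b = quadForm P b + quadForm R g := by
      conv_lhs => rw [h1]
      rw [add_dotProduct, dotProduct_comm (Cᵀ *ᵥ g), dotProduct_mulVec_transpose, ← hRg,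
        dotProduct_comm _ g, quadForm, quadForm]
    have h5 := two_mul_dotProduct_le hV a (P *ᵥ b)
    rw [quadForm_invV, h2, h3, h4] at h5
    have h6 := quadForm_riccati (A := A) (C := C) (Q := Q) (R := R) (θ := θ) P x
    rw [hfix, ← ha] at h6
    rw [hKx]
    have h7 := mul_nonneg hθ0.le (dotProduct_self_nonneg (P *ᵥ b))
    linarith [hQ.quadForm_pos hx, hR.quadForm_nonneg g]
  have hlim := tendsto_transpose_pow (tendsto_pow_of_lyapunov hP key)
  rw [transpose_transpose] at hlim
  exact isStable_of_tendsto_pow hlim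

end Uniqueness

end URSF

/-! ### The convergence theorem -/

theorem theorem5 {n m k : ℕ} (hn : 0 < n) (hk : n ≤ k)
    (A : Matrix (Fin n) (Fin n) ℝ) (C : Matrix (Fin m) (Fin n) ℝ)
    (Q : Matrix (Fin n) (Fin n) ℝ) (R : Matrix (Fin m) (Fin m) ℝ)
    (hQ : Q.PosDef) (hR : R.PosDef)
    (hobs : URSF.IsObservable A C)
    (B : Matrix (Fin n) (Fin n) ℝ) (hB : B * Bᵀ = Q)
    (G : Matrix (Fin n) (Fin m) ℝ) (ρ α : ℝ) (hα0 : 0 < α) (hα1 : α ≤ 1)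
    (hρ1 : 1 < ρ) (hρ2 : ENNReal.ofReal ρ < (URSF.maxModulus (A - α • (G * C)))⁻¹) :
    ∃ S : Matrix (Fin n) (Fin n) ℝ,
      S.PosDef ∧
      (∀ X : Matrix (Fin n) (Fin n) ℝ, URSF.LyapunovEq A C Q R G ρ α X ↔ X = S) ∧
      0 < min (URSF.beta C R ρ α S) (URSF.phiK A C R B k) ∧
      ∀ θ : ℝ, 0 < θ → θ ≤ min (URSF.beta C R ρ α S) (URSF.phiK A C R B k) →
        ∃ (P : Matrix (Fin n) (Fin n) ℝ) (L : Matrix (Fin n) (Fin m) ℝ),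
          (P.PosDef ∧ (URSF.invV C R θ P).PosDef ∧ URSF.riccati A C Q R θ P = P) ∧
          (∀ P' : Matrix (Fin n) (Fin n) ℝ,
            P'.PosDef → URSF.riccati A C Q R θ P' = P' → P' = P) ∧
          (∀ P₀ : Matrix (Fin n) (Fin n) ℝ, P₀.PosDef → (S - P₀).PosSemidef →
            (∀ t : ℕ, (URSF.riccatiSeq A C Q R θ P₀ t).PosDef ∧
              (URSF.invV C R θ (URSF.riccatiSeq A C Q R θ P₀ t)).PosDef) ∧
            Tendsto (fun t => URSF.riccatiSeq A C Q R θ P₀ t) atTop (𝓝 P) ∧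
            Tendsto (fun t => URSF.gain C R (URSF.riccatiSeq A C Q R θ P₀ t)) atTop (𝓝 L)) ∧
          URSF.IsStable (A * (1 - L * C)) := by

  have hM := URSF.tendsto_pow_of_maxModulus_lt (one_pos.trans hρ1) hρ2
  obtain ⟨S, hS⟩ := URSF.existsUnique_lyapunov hM (G * R * Gᵀ + Q)
  have hLyap : ∀ X, URSF.LyapunovEq A C Q R G ρ α X ↔ X = S := fun X =>
    URSF.lyapunovEq_iff.trans (hS X)
  have hSeq := (hLyap S).2 rfl
  have hSpd := URSF.posDef_of_lyapunovEq hQ hR hM hSeq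
  refine ⟨S, hSpd, hLyap, lt_min (URSF.beta_pos hn hR hρ1 hα0 hα1 hSpd)
    (URSF.phiK_pos hn hk hR hobs), fun θ hθ0 hθ => ?_⟩
  have hβ := hθ.trans (min_le_left _ _)
  have hφ := hθ.trans (min_le_right _ _)
  have hk0 := hn.trans_le hk
  have hV := URSF.posDef_invV_of_le_beta hR hρ1 hα0 hα1 hSpd hβ
  have hle := URSF.riccati_le_of_le_beta hR hρ1 hα0 hα1 hSpd hSeq hβ
  obtain ⟨P, ⟨hP, hPV, hPfix⟩, hlim⟩ := URSF.exists_tendsto_riccatiSeq hQ hR hSpd hV hle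
    fun P P' hP hP' hV hV' hf hf' =>
      URSF.riccati_unique hk0 hQ hR hB hθ0 hφ hP hP' hV.isUnit_det hV'.isUnit_det hf hf'
  refine ⟨P, URSF.gain C R P, ⟨hP, hPV, hPfix⟩, fun P' hP' hf' => ?_, fun P₀ hP₀ hP₀S => ?_,
    URSF.isStable_gain hQ hR hθ0 hP hPV hPfix⟩
  -- A singular `invV` has inverse `0` by convention, which forces `P' = Q`; but `Q ≤ S` makes
  -- `invV` positive definite at `Q`.
  · have hV' : IsUnit (URSF.invV C R θ P').det := by
      by_contra h
      have hPQ : P' = Q := by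
        rw [← hf', URSF.riccati, nonsing_inv_apply_not_isUnit _ h, Matrix.mul_zero,
          Matrix.zero_mul, zero_add]
      rw [hPQ] at h
      exact h (URSF.posDef_invV_of_le hR hQ hSpd hV
        fun x => (URSF.le_riccati hV x).trans (hle x)).isUnit_det
    exact URSF.riccati_unique hk0 hQ hR hB hθ0 hφ hP' hP hV' hPV.isUnit_det hf' hPfix
  · have hP₀S' : ∀ x, URSF.quadForm P₀ x ≤ URSF.quadForm S x := fun x => by
      have := (URSF.posSemidef_iff.1 hP₀S).2 x
      rw [URSF.quadForm_sub] at this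
      linarith
    have hmem := URSF.riccatiSeq_mem hQ hR hSpd hV hle hP₀ hP₀S'
    exact ⟨fun t => ⟨(hmem t).1, URSF.posDef_invV_of_le hR (hmem t).1 hSpd hV (hmem t).2⟩,
      hlim P₀ hP₀ hP₀S', URSF.tendsto_gain hR hP (hlim P₀ hP₀ hP₀S')⟩
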